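/- Let $n\ge 0$. A polygonal chain $E_n$ of $n$ edges is an open chain with vertices $a_0,\dots,a_n\in\mathbb R^3$, or a closed chain with vertices $a_0,\dots,a_n=a_0$, that is simple (the piecewise linear curve through its vertices has no self-intersections). The configuration space $EW_n$ of the open chains, and likewise that of the closed chains, carries the topology given by the vertex coordinates. A direction $\xi\in S^2$ is generic for $E_n$ if the orthogonal projection of $E_n$ to the plane with normal vector $\xi$ has only transversal double points, none of which is the projection of a vertex. Then the projection, with over and under information at its crossings, is a diagram $K((E_n)_\xi)$: a knotoid diagram in $S^2$ for an open chain, a knot diagram for a closed chain. Diagrams are taken up to isotopy of $S^2$, oriented, and, for closed chains, with the image of $a_0$ as base point; they are recorded by their signed Gauss words. The bracket polynomial of a diagram $K$ is $$\langle K\rangle=\sum_S A^{\sigma(S)}d^{\|S\|-1},\qquad d=-A^2-A^{-2},$$ where $S$ runs over the states (a choice of the $A$- or the $B$-smoothing at each crossing), $\sigma(S)$ is the number of $A$-smoothings minus the number of $B$-smoothings, and $\|S\|$ is the number of components of $S$. For a set $\mathcal P$ of diagrams let $$p_{\mathcal P}(E_n)=\frac{\mathrm{Area}\{\xi\in S^2:\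 \xi\text{ is generic for }E_n,\ K((E_n)_\xi)\in\mathcal P\}}{\mathrm{Area}(S^2)} .$$ Then, for open chains and for closed chains alike: 1. Only finitely many diagrams $K_1,\dots,K_k$, $k=k(n)$, occur as generic projections of chains of $n$ edges, and for every chain almost every direction is generic. 2. For every set $\mathcal P$ of diagrams, the set of directions above is measurable, and $p_{\mathcal P}$ is a continuous function on $EW_n$. In particular, $p^{(n)}_i$, the probability that a projection gives the diagram $K_i$, is continuous, and so is the probability that a projection represents a given knotoid (respectively knot), that is, a given equivalence class of diagrams in $S^2$ under the Reidemeister moves away from the endpoints. 3. The bracket polynomial of $E_n$, $$\langle E_n\rangle=\frac1{4\pi}\int_{S^2}\langle K((E_n)_\xi)\rangle\,dS$$ (coefficientwise, over the generic directions), exists, and $\langle E_n\rangle=\sum_{i=1}^{k}p^{(n)}_i\langle K_i\rangle$. 4. There is an $m$, depending only on $n$ and on whether the chains are open or closed, such that all $\langle K_i\rangle$ and all $\langle E_n\rangle$ lie in the space $L_m$ of real Laurent polynomials in $A$ with exponents between $-m$ and $m$; and $E_n\mapsto\langle E_n\rangle$ is a continuous map from $EW_n$ to $L_m$ with the Euclidean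 norm on coefficient vectors. -/

import Mathlib

open scoped LaurentPolynomial Classical

noncomputable section

/-! ### Polygonal chains in 3-space -/

/-- Euclidean 3-space. -/
abbrev Space3 : Type := EuclideanSpace ℝ (Fin 3)

/-- A chain is either an open or a closed polygonal curve. -/
inductive ChainKind : Type
  | opened : ChainKind
  | closed : ChainKind

/-- The vertices of a polygonal chain of `n` edges; the `i`-th edge joins vertex `i` to vertex
`i + 1`. A closed chain repeats its first vertex as its last one, see `chainSpace`. -/
abbrev Vertices (n : ℕ) : Type := Fin (n + 1) → Space3

/-- The piecewise linear parametrization of the chain on `[0, n]`: on `[i, i + 1]` it runs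
linearly along the `i`-th edge. -/
def chainPoint {n : ℕ} (v : Vertices n) (u : ℝ) : Space3 :=
  if h : ⌊u⌋₊ < n then
    AffineMap.lineMap (v ⟨⌊u⌋₊, by omega⟩) (v ⟨⌊u⌋₊ + 1, by omega⟩) (u - (⌊u⌋₊ : ℝ))
  else v (Fin.last n)

/-- The vector of the oriented edge that is being traversed at time `u`. -/
def edgeVector {n : ℕ} (v : Vertices n) (u : ℝ) : Space3 :=
  if h : ⌊u⌋₊ < n then v ⟨⌊u⌋₊ + 1, by omega⟩ - v ⟨⌊u⌋₊, by omega⟩ else 0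

/-- The set of times; for a closed chain the times `0` and `n` are the same point of the curve,
so that `n` is left out. -/
def chainTimes : ChainKind → ℕ → Set ℝ
  | ChainKind.opened, n => Set.Icc 0 (n : ℝ)
  | ChainKind.closed, n => Set.Ico 0 (n : ℝ)

/-- The configuration space of simple (embedded) open, respectively closed, polygonal chains of
`n` edges, with the topology given by the coordinates of the vertices. -/
def chainSpace (c : ChainKind) (n : ℕ) : Set (Vertices n) :=
  {v | Set.InjOn (chainPoint v) (chainTimes c n) ∧
    (c = ChainKind.closed → v (Fin.last n) = v 0)}

/-! ### Projections -/

/-- The sphere of projection directions. -/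
abbrev Direction : Type := Metric.sphere (0 : Space3) 1

/-- The surface area of the unit sphere. -/
def sphereArea : MeasureTheory.Measure Direction :=
  (MeasureTheory.volume : MeasureTheory.Measure Space3).toSphere

/-- Orthogonal projection to the plane through the origin with normal vector `ξ`. -/
def planeProjection (ξ : Direction) (x : Space3) : Space3 :=
  (Submodule.span ℝ {(ξ : Space3)})ᗮ.starProjection x

/-- The height of a point over that plane; the viewer looks at the plane from the tip of `ξ`. -/
def height (ξ : Direction) (x : Space3) : ℝ := inner ℝ (ξ : Space3) x

/-- The signed area, seen from the tip of `ξ`, of the parallelogram spanned by the projections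
of `a` and `b` (the scalar triple product of `a`, `b`, `ξ`). -/
def planarDet (ξ : Direction) (a b : Space3) : ℝ :=
  (Matrix.of ![(a : Fin 3 → ℝ), (b : Fin 3 → ℝ), ((ξ : Space3) : Fin 3 → ℝ)]).det

/-- At the distinct times `u` and `u'` the projected chain passes through the same point. -/
def Crosses (c : ChainKind) {n : ℕ} (v : Vertices n) (ξ : Direction) (u u' : ℝ) : Prop :=
  u ∈ chainTimes c n ∧ u' ∈ chainTimes c n ∧ u ≠ u' ∧
    planeProjection ξ (chainPoint v u) = planeProjection ξ (chainPoint v u')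

/-- The projection along `ξ` is generic: the multiple points of the projected chain are transversal
double points, and none of them is the projection of a vertex. (An edge parallel to `ξ`, or two
projected edges that overlap, violate this, so there are only finitely many double points.) -/
def IsGeneric (c : ChainKind) {n : ℕ} (v : Vertices n) (ξ : Direction) : Prop :=
  ∀ u u', Crosses c v ξ u u' →
    (∀ k : ℕ, u ≠ (k : ℝ)) ∧
    planarDet ξ (edgeVector v u) (edgeVector v u') ≠ 0 ∧
    ∀ u'', Crosses c v ξ u u'' → u'' = u'

/-! ### Knotoid diagrams and knot diagrams as signed Gauss words

A generic projection of an open chain is a connected knotoid diagram. Up to isotopy of the sphere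
`S²` it is determined by its oriented signed Gauss word: the list of the passages through the
crossings in the order in which the curve makes them, where each passage records the name of the
crossing, whether the curve passes over or under, and the sign of the crossing. For a closed chain
the word depends on the initial vertex, too, and the diagram is the word up to rotation. -/

/-- A passage of the curve through a crossing. -/
structure Passage : Type where
  label : ℕ
  isOver : Bool
  isPositive : Bool

abbrev GaussWord : Type := List Passage

/-- The times at which the projected chain is at a double point. -/
def crossingTimes (c : ChainKind) {n : ℕ} (v : Vertices n) (ξ : Direction) : Set ℝ :=
  {u | ∃ u', Crosses c v ξ u u'}

/-- The other time at which the projected chain is at the double point of time `u`. -/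
def mate (c : ChainKind) {n : ℕ} (v : Vertices n) (ξ : Direction) (u : ℝ) : ℝ :=
  if h : ∃ u', Crosses c v ξ u u' then h.choose else u

/-- The passage at the crossing time `u`. A crossing is named by the position of its first
passage in the list of all the passages. It is positive if the overpassing direction followed by
the underpassing direction is a positive frame of the projection plane. -/
def passageAt (c : ChainKind) {n : ℕ} (v : Vertices n) (ξ : Direction) (u : ℝ) : Passage where
  label := {t ∈ crossingTimes c v ξ | t < min u (mate c v ξ u)}.ncard
  isOver := decide (height ξ (chainPoint v (mate c v ξ u)) < height ξ (chainPoint v u))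
  isPositive := decide (0 <
    (height ξ (chainPoint v u) - height ξ (chainPoint v (mate c v ξ u))) *
      planarDet ξ (edgeVector v u) (edgeVector v (mate c v ξ u)))

/-- The diagram `K((E)_ξ)` of the projection of the chain along the generic direction `ξ`. -/
def projectionDiagram (c : ChainKind) {n : ℕ} (v : Vertices n) (ξ : Direction) : GaussWord :=
  if h : (crossingTimes c v ξ).Finite then
    (h.toFinset.sort (fun s t : ℝ => s ≤ t)).map (passageAt c v ξ)
  else []

/-- The diagrams `K_1, …, K_k` that are realized by generic projections of chains of `n` edges. -/
def realizableDiagrams (c : ChainKind) (n : ℕ) : Set GaussWord :=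
  {K | ∃ v ∈ chainSpace c n, ∃ ξ : Direction, IsGeneric c v ξ ∧ projectionDiagram c v ξ = K}

/-! ### Equivalence of diagrams -/

/-- Renaming of the crossings. -/
def renameCrossings (f : ℕ ≃ ℕ) (w : GaussWord) : GaussWord :=
  w.map fun p => ⟨f p.label, p.isOver, p.isPositive⟩

/-- The words of the diagrams (with arbitrary names of the crossings) of knotoids in `S²`,
respectively of knots. -/
def IsDiagram (c : ChainKind) (w : GaussWord) : Prop :=
  ∃ n, ∃ K ∈ realizableDiagrams c n, ∃ f : ℕ ≃ ℕ, w = renameCrossings f K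

/-- Removal of a kink (first Reidemeister move). -/
def ReidemeisterOne (w w' : GaussWord) : Prop :=
  ∃ (x y : GaussWord) (a : ℕ) (o s : Bool),
    w = x ++ [⟨a, o, s⟩, ⟨a, !o, s⟩] ++ y ∧ w' = x ++ y

/-- Removal of a bigon one side of which passes over the other (second Reidemeister move). -/
def ReidemeisterTwo (w w' : GaussWord) : Prop :=
  ∃ (x y z P : GaussWord) (a b : ℕ) (o s : Bool),
    (P = [⟨a, !o, s⟩, ⟨b, !o, !s⟩] ∨ P = [⟨b, !o, !s⟩, ⟨a, !o, s⟩]) ∧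
    w = x ++ [⟨a, o, s⟩, ⟨b, o, !s⟩] ++ y ++ P ++ z ∧ w' = x ++ y ++ z

/-- Two passages, in the given order or in the opposite one. -/
def orderedPair (d : Bool) (p q : Passage) : GaussWord := if d then [p, q] else [q, p]

/-- The third Reidemeister move. A top strand `T`, a middle strand `M` and a bottom strand `B` meet
in the crossings `a = TM`, `b = TB`, `c = MB` of signs `ea`, `eb`, `ec`; `dT` tells whether `T`
passes `a` before `b`, `dM` whether `M` passes `a` before `c`, and `dB` whether `B` passes `b`
before `c`. The two conditions on signs say that the three arcs bound a triangular face, as three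
oriented lines in the plane do. The move reverses the three orders; the three strands
may come in any order along the curve. -/
def ReidemeisterThree (w w' : GaussWord) : Prop :=
  ∃ (x y z t β₁ β₂ β₃ : GaussWord) (a b c : ℕ) (ea eb ec dT dM dB : Bool),
    ((dB == eb) = (dM == ea)) ∧ ((dB == ec) = (dT == ea)) ∧
    [β₁, β₂, β₃].Perm
      [orderedPair dT ⟨a, true, ea⟩ ⟨b, true, eb⟩,
       orderedPair dM ⟨a, false, ea⟩ ⟨c, true, ec⟩,
       orderedPair dB ⟨b, false, eb⟩ ⟨c, false, ec⟩] ∧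
    w = x ++ β₁ ++ y ++ β₂ ++ z ++ β₃ ++ t ∧
    w' = x ++ β₁.reverse ++ y ++ β₂.reverse ++ z ++ β₃.reverse ++ t

/-- One step between diagrams: renaming of crossings, change of the initial point of a closed
diagram, or a Reidemeister move. In particular no move passes a strand over or under an endpoint,
and all the words that occur are words of diagrams on the sphere. -/
def DiagramMove (c : ChainKind) (w w' : GaussWord) : Prop :=
  IsDiagram c w ∧ IsDiagram c w' ∧
    ((∃ f : ℕ ≃ ℕ, w' = renameCrossings f w) ∨
      (c = ChainKind.closed ∧ w.IsRotated w') ∨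
      ReidemeisterOne w w' ∨ ReidemeisterTwo w w' ∨ ReidemeisterThree w w')

/-- Equivalence of knotoid diagrams in `S²` (of knot diagrams, for closed chains): the two diagrams
represent the same knotoid (knot). -/
def DiagramEquiv (c : ChainKind) : GaussWord → GaussWord → Prop :=
  Relation.EqvGen (DiagramMove c)

/-! ### The bracket polynomial of a diagram -/

/-- The arcs of the diagram `w` are numbered `0, …, w.length`, in the order of the curve: the `k`-th
passage enters along arc `k` and leaves along arc `k + 1`; for a closed diagram, the last arc and
arc `0` are the same. A state is given by the set `S` of the crossings that are smoothed by the
`A`-smoothing, the others being smoothed by the `B`-smoothing. The `A`-smoothing of a positive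
crossing and the `B`-smoothing of a negative one respect the orientation, the two other ones do not.
This is the relation of two arcs being joined to each other in the state. -/
def JoinedInState (c : ChainKind) (w : GaussWord) (S : Finset ℕ)
    (x y : Fin (w.length + 1)) : Prop :=
  (c = ChainKind.closed ∧ x = 0 ∧ y = Fin.last w.length) ∨
  ∃ i j : Fin w.length, i ≠ j ∧ (w.get i).label = (w.get j).label ∧
    if (w.get i).label ∈ S ↔ (w.get i).isPositive = true then
      x = i.castSucc ∧ y = j.succ
    else
      (x = i.castSucc ∧ y = j.castSucc) ∨ (x = i.succ ∧ y = j.succ)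

/-- The number `||S||` of components of a state. -/
def stateComponents (c : ChainKind) (w : GaussWord) (S : Finset ℕ) : ℕ :=
  Nat.card (Quot (JoinedInState c w S))

/-- The crossings of a diagram. -/
def crossings (w : GaussWord) : Finset ℕ := (w.map Passage.label).toFinset

/-- The bracket polynomial `⟨K⟩ = ∑_S A ^ σ(S) * d ^ (||S|| - 1)` with `d = -A² - A⁻²`, where
`σ(S)` is the number of `A`-smoothings minus the number of `B`-smoothings of the state. -/
def bracket (c : ChainKind) (w : GaussWord) : ℝ[T;T⁻¹] :=
  ∑ S ∈ (crossings w).powerset,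
    LaurentPolynomial.T ((S.card : ℤ) - ((crossings w \ S).card : ℤ)) *
      (-LaurentPolynomial.T 2 - LaurentPolynomial.T (-2)) ^ (stateComponents c w S - 1)

/-! ### The bracket polynomial of a chain in 3-space -/

/-- The generic directions along which the diagram of the projection belongs to `P`. -/
def directionSet (c : ChainKind) {n : ℕ} (v : Vertices n) (P : Set GaussWord) : Set Direction :=
  {ξ | IsGeneric c v ξ ∧ projectionDiagram c v ξ ∈ P}

/-- The probability that the diagram of a projection belongs to `P`: the ratio of the area of the
set of these directions to the area of the sphere. -/
def projectionProb (c : ChainKind) {n : ℕ} (v : Vertices n) (P : Set GaussWord) : ℝ :=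
  sphereArea.real (directionSet c v P) / sphereArea.real Set.univ

/-- The probability that a projection gives the diagram `K`. -/
def diagramProb (c : ChainKind) {n : ℕ} (v : Vertices n) (K : GaussWord) : ℝ :=
  projectionProb c v {K}

/-- The probability that a projection gives a diagram of the knotoid (knot) represented by `K`. -/
def typeProb (c : ChainKind) {n : ℕ} (v : Vertices n) (K : GaussWord) : ℝ :=
  projectionProb c v {w | DiagramEquiv c K w}

/-- The bracket polynomial `⟨E_n⟩ = ∑_i p_i ⟨K_i⟩` of a chain of `n` edges, the sum being over the
diagrams that are realized by projections of chains of `n` edges. -/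
def chainBracket (c : ChainKind) {n : ℕ} (v : Vertices n) : ℝ[T;T⁻¹] :=
  ∑ᶠ K ∈ realizableDiagrams c n, diagramProb c v K • bracket c K

/-- The Laurent polynomial only has terms of exponents between `-m` and `m`. -/
def HasDegreeLE (m : ℕ) (f : ℝ[T;T⁻¹]) : Prop :=
  ∀ k : ℤ, f.coeff k ≠ 0 → -(m : ℤ) ≤ k ∧ k ≤ (m : ℤ)

/-- The vector of the coefficients of exponents between `-m` and `m`, in the Euclidean space. -/
def coeffVector (m : ℕ) (f : ℝ[T;T⁻¹]) :
    EuclideanSpace ℝ (Finset.Icc (-(m : ℤ)) (m : ℤ)) :=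
  WithLp.toLp 2 fun k => f.coeff (k : ℤ)

end

/-! Everything rests on two facts about pairs (simple chain, direction). First, genericity is an
open condition and the diagram is locally constant on generic pairs
(`eventually_isGeneric_and_projectionDiagram_eq`). Second, for a fixed simple chain almost every
direction is generic (`ae_isGeneric`). Hence, when a chain tends to a limit chain, the indicators of
the direction sets converge almost everywhere; the sphere has finite area, so the probabilities
converge (`projectionProb_continuous`), whatever class of diagrams is chosen.

Local constancy: by Cramer's rule, crossing parameters and height differences are quotients of
triple products, continuous where two projected edges are transversal. Their order and signs
therefore persist. New crossings are excluded by compactness of the parameter square; consecutive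
edges, which always meet, need a separate argument (`eventually_adjacent_edges`).

Almost sure genericity: a vertex lying over an edge, or two parallel edges crossing, confines the
direction to a plane. A triple point confines it to the zero set of a quadratic form, which is not
identically zero because edges that cross in a transversal projection are skew
(`ae_concurrencyForm_ne_zero`).

Only `n * n` ordered pairs of edges are available, so finitely many words occur. The integral of the
bracket is then a finite sum over disjoint open sets on which the integrand is constant. -/

/-! ### Triple products and projections -/

/-- The scalar triple product of three vectors of Euclidean 3-space. -/
def tripleProduct (a b x : Space3) : ℝ :=
  a 0 * (b 1 * x 2 - b 2 * x 1) - a 1 * (b 0 * x 2 - b 2 * x 0) + a 2 * (b 0 * x 1 - b 1 * x 0)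

theorem planarDet_eq (ξ : Direction) (a b : Space3) :
    planarDet ξ a b = tripleProduct a b ξ := by
  unfold planarDet tripleProduct
  rw [Matrix.det_fin_three]
  simp
  ring

theorem tripleProduct_continuous {X : Type*} [TopologicalSpace X] {f g h : X → Space3}
    (hf : Continuous f) (hg : Continuous g) (hh : Continuous h) :
    Continuous fun x => tripleProduct (f x) (g x) (h x) := by
  unfold tripleProduct
  fun_prop

theorem planeProjection_eq (ξ : Direction) (x : Space3) :
    planeProjection ξ x = x - inner ℝ (ξ : Space3) x • (ξ : Space3) := by
  have h : ‖(ξ : Space3)‖ = 1 := by simp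
  unfold planeProjection
  rw [Submodule.starProjection_orthogonal', sub_apply,
    Submodule.starProjection_unit_singleton ℝ h]
  rfl

theorem inner_direction_self (ξ : Direction) : inner ℝ (ξ : Space3) (ξ : Space3) = 1 := by
  rw [real_inner_self_eq_norm_sq]; simp

theorem planeProjection_eq_planeProjection_iff {ξ : Direction} {x y : Space3} :
    planeProjection ξ x = planeProjection ξ y ↔ ∃ l : ℝ, x - y = l • (ξ : Space3) := by
  rw [planeProjection_eq, planeProjection_eq]
  constructor
  · intro h
    refine ⟨inner ℝ (ξ : Space3) x - inner ℝ (ξ : Space3) y, ?_⟩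
    rw [sub_smul]
    exact sub_eq_sub_iff_sub_eq_sub.1 h
  · rintro ⟨l, h⟩
    obtain rfl : x = y + l • (ξ : Space3) := by rw [← h]; abel
    rw [inner_add_right, inner_smul_right, inner_direction_self]
    module

/-! ### Edges -/

/-- The vector of the `i`-th edge. -/
def edge {n : ℕ} (v : Vertices n) (i : Fin n) : Space3 := v i.succ - v i.castSucc

/-- The point that divides the `i`-th edge in the ratio `s : 1 - s`. -/
def edgePoint {n : ℕ} (v : Vertices n) (i : Fin n) (s : ℝ) : Space3 :=
  v i.castSucc + s • edge v i

theorem edge_continuous {n : ℕ} (i : Fin n) : Continuous fun v : Vertices n => edge v i := by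
  unfold edge; fun_prop

theorem floor_edge_add {n : ℕ} (i : Fin n) {s : ℝ} (h0 : 0 ≤ s) (h1 : s < 1) :
    ⌊(i : ℝ) + s⌋₊ = (i : ℕ) := by
  rw [Nat.floor_eq_iff (by positivity)]
  constructor <;> linarith

theorem edgeVector_add {n : ℕ} (v : Vertices n) (i : Fin n) {s : ℝ} (h0 : 0 ≤ s) (h1 : s < 1) :
    edgeVector v (i + s) = edge v i := by
  unfold edgeVector
  simp only [floor_edge_add i h0 h1, i.isLt, dite_true]
  rfl

theorem edgePoint_one {n : ℕ} (v : Vertices n) (i : Fin n) : edgePoint v i 1 = v i.succ := by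
  simp [edgePoint, edge]

theorem chainPoint_natCast {n : ℕ} (v : Vertices n) (k : Fin (n + 1)) :
    chainPoint v (k : ℕ) = v k := by
  unfold chainPoint
  simp only [Nat.floor_natCast]
  split_ifs with h
  · simp
  · congr 1
    ext
    simp
    omega

/-- At `s = 1` the floor already selects the next edge (or the default value at the end); both
descriptions agree at the shared vertex, so the closed interval is allowed. -/
theorem chainPoint_add {n : ℕ} (v : Vertices n) (i : Fin n) {s : ℝ} (hs : s ∈ Set.Icc (0 : ℝ) 1) :
    chainPoint v (i + s) = edgePoint v i s := by
  rcases hs.2.lt_or_eq with h1 | rfl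
  · unfold chainPoint
    simp only [floor_edge_add i hs.1 h1, i.isLt, dite_true, AffineMap.lineMap_apply,
      add_sub_cancel_left, vsub_eq_sub, vadd_eq_add]
    rw [add_comm]
    rfl
  · rw [edgePoint_one, ← chainPoint_natCast v i.succ]
    simp

theorem chainTimes_subset (c : ChainKind) (n : ℕ) : chainTimes c n ⊆ Set.Icc 0 (n : ℝ) := by
  cases c
  · exact subset_rfl
  · exact Set.Ico_subset_Icc_self

theorem mem_chainTimes_of_lt (c : ChainKind) {n : ℕ} {u : ℝ} (h0 : 0 ≤ u) (h : u < n) :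
    u ∈ chainTimes c n := by
  cases c
  · exact ⟨h0, h.le⟩
  · exact ⟨h0, h⟩

theorem edge_add_mem_chainTimes (c : ChainKind) {n : ℕ} (i : Fin n) {s : ℝ} (h0 : 0 ≤ s)
    (h1 : s < 1) : (i : ℝ) + s ∈ chainTimes c n := by
  refine mem_chainTimes_of_lt _ (by positivity) ?_
  have : ((i : ℕ) : ℝ) + 1 ≤ n := by exact_mod_cast i.isLt
  linarith

theorem exists_edge_of_lt {n : ℕ} {u : ℝ} (h0 : 0 ≤ u) (h : u < n) :
    ∃ (i : Fin n) (s : ℝ), 0 ≤ s ∧ s < 1 ∧ u = i + s :=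
  ⟨⟨⌊u⌋₊, (Nat.floor_lt h0).2 h⟩, u - ⌊u⌋₊, by linarith [Nat.floor_le h0],
    by linarith [Nat.lt_floor_add_one u], by simp⟩

theorem exists_edge_of_le {n : ℕ} {u : ℝ} (hn : 0 < n) (h0 : 0 ≤ u) (h : u ≤ n) :
    ∃ (i : Fin n) (s : ℝ), s ∈ Set.Icc (0 : ℝ) 1 ∧ u = i + s := by
  rcases h.lt_or_eq with h | rfl
  · obtain ⟨i, s, hs, hs', e⟩ := exists_edge_of_lt h0 h
    exact ⟨i, s, ⟨hs, hs'.le⟩, e⟩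
  · refine ⟨⟨n - 1, by omega⟩, 1, by simp, ?_⟩
    push_cast [Nat.cast_sub (show 1 ≤ n from hn)]
    ring

theorem edge_add_inj {n : ℕ} {i j : Fin n} {s t : ℝ} (hs : 0 ≤ s) (hs' : s < 1) (ht : 0 ≤ t)
    (ht' : t < 1) (h : (i : ℝ) + s = j + t) : i = j ∧ s = t := by
  have h1 := floor_edge_add i hs hs'
  rw [h, floor_edge_add j ht ht'] at h1
  obtain rfl : i = j := Fin.ext h1.symm
  exact ⟨rfl, by linarith⟩

theorem edge_add_ne_natCast {n : ℕ} (i : Fin n) {s : ℝ} (h0 : 0 < s) (h1 : s < 1) (k : ℕ) :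
    (i : ℝ) + s ≠ k := by
  intro h
  have h2 := floor_edge_add i h0.le h1
  rw [h, Nat.floor_natCast] at h2
  subst h2
  linarith

/-! ### Crossings -/

theorem Crosses.symm {c : ChainKind} {n : ℕ} {v : Vertices n} {ξ : Direction} {u u' : ℝ}
    (h : Crosses c v ξ u u') : Crosses c v ξ u' u :=
  ⟨h.2.1, h.1, h.2.2.1.symm, h.2.2.2.symm⟩

theorem Crosses.trans {c : ChainKind} {n : ℕ} {v : Vertices n} {ξ : Direction} {u u' u'' : ℝ}
    (h : Crosses c v ξ u u') (h' : Crosses c v ξ u' u'') (hne : u ≠ u'') : Crosses c v ξ u u'' :=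
  ⟨h.1, h'.2.1, hne, h.2.2.2.trans h'.2.2.2⟩

theorem Crosses.pos {c : ChainKind} {n : ℕ} {v : Vertices n} {ξ : Direction} {u u' : ℝ}
    (h : Crosses c v ξ u u') : 0 < n := by
  rcases Nat.eq_zero_or_pos n with rfl | hn
  · have hu := chainTimes_subset c 0 h.1
    have hu' := chainTimes_subset c 0 h.2.1
    rw [Nat.cast_zero, Set.Icc_self, Set.mem_singleton_iff] at hu hu'
    exact absurd (hu.trans hu'.symm) h.2.2.1
  · exact hn

/-- The parameter, on the line of the `i`-th edge, of its crossing with the line of the `j`-th edge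
in the projection along `ξ`. -/
noncomputable def crossingParam {n : ℕ} (v : Vertices n) (ξ : Space3) (p : Fin n × Fin n) : ℝ :=
  tripleProduct (v p.2.castSucc - v p.1.castSucc) (edge v p.2) ξ /
    tripleProduct (edge v p.1) (edge v p.2) ξ

/-- The time at which the `i`-th edge crosses the `j`-th edge in the projection along `ξ`. -/
noncomputable def crossingTime {n : ℕ} (v : Vertices n) (ξ : Space3) (p : Fin n × Fin n) : ℝ :=
  p.1 + crossingParam v ξ p

/-- The pairs of edges that cross transversally at interior points in the projection along `ξ`. -/
def crossingPairs {n : ℕ} (v : Vertices n) (ξ : Space3) : Set (Fin n × Fin n) :=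
  {p | tripleProduct (edge v p.1) (edge v p.2) ξ ≠ 0 ∧
    crossingParam v ξ p ∈ Set.Ioo (0 : ℝ) 1 ∧ crossingParam v ξ p.swap ∈ Set.Ioo (0 : ℝ) 1}

theorem tripleProduct_swap (a b x : Space3) : tripleProduct b a x = -tripleProduct a b x := by
  unfold tripleProduct; ring

theorem swap_mem_crossingPairs {n : ℕ} {v : Vertices n} {ξ : Space3} {p : Fin n × Fin n}
    (h : p ∈ crossingPairs v ξ) : p.swap ∈ crossingPairs v ξ := by
  refine ⟨?_, h.2.2, by simpa using h.2.1⟩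
  rw [tripleProduct_swap]
  simpa using h.1

/-- Cramer's rule for three linear equations in the unknowns `s`, `t`, `l`. The formula for `l` has
a numerator independent of `ξ`, which vanishes exactly when the lines of the two edges are coplanar.
-/
theorem edgePoint_sub_edgePoint_iff {n : ℕ} {v : Vertices n} {ξ : Space3} {i j : Fin n} {s t l : ℝ}
    (hD : tripleProduct (edge v i) (edge v j) ξ ≠ 0) :
    edgePoint v i s - edgePoint v j t = l • ξ ↔
      s = crossingParam v ξ (i, j) ∧ t = crossingParam v ξ (j, i) ∧
      l = -(tripleProduct (edge v i) (edge v j) (v j.castSucc - v i.castSucc) /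
        tripleProduct (edge v i) (edge v j) ξ) := by
  have hD' : tripleProduct (edge v j) (edge v i) ξ ≠ 0 := by
    rw [tripleProduct_swap]; simpa using hD
  unfold crossingParam edgePoint
  simp only [neg_div', eq_div_iff hD, eq_div_iff hD']
  generalize edge v i = a at *
  generalize edge v j = b at *
  generalize v i.castSucc = p at *
  generalize v j.castSucc = q at *
  constructor
  · intro h
    have h0 := congrArg (fun x : Space3 => x 0) h
    have h1 := congrArg (fun x : Space3 => x 1) h
    have h2 := congrArg (fun x : Space3 => x 2) h
    simp at h0 h1 h2
    have e0 : q 0 = p 0 + s * a 0 - t * b 0 - l * ξ 0 := by linarith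
    have e1 : q 1 = p 1 + s * a 1 - t * b 1 - l * ξ 1 := by linarith
    have e2 : q 2 = p 2 + s * a 2 - t * b 2 - l * ξ 2 := by linarith
    simp only [tripleProduct, PiLp.sub_apply, e0, e1, e2]
    refine ⟨?_, ?_, ?_⟩ <;> ring
  · rintro ⟨hs, ht, hl⟩
    -- Multiplying each coordinate by the determinant replaces the unknowns by their numerators and
    -- leaves a polynomial identity.
    have key : ∀ k : Fin 3, tripleProduct a b ξ * ((p k + s * a k) - (q k + t * b k) - l * ξ k)
        = 0 := by
      intro k
      have ht' : t * tripleProduct a b ξ = -tripleProduct (p - q) a ξ := by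
        rw [← ht, tripleProduct_swap a b]; ring
      have : tripleProduct a b ξ * ((p k + s * a k) - (q k + t * b k) - l * ξ k)
        = tripleProduct a b ξ * (p k - q k) + (s * tripleProduct a b ξ) * a k -
          (t * tripleProduct a b ξ) * b k - (l * tripleProduct a b ξ) * ξ k := by ring
      rw [this, hs, ht', hl]
      fin_cases k <;> simp [tripleProduct] <;> ring
    ext k
    have := (mul_eq_zero.1 (key k)).resolve_left hD
    simp
    linarith

theorem crosses_of_mem_crossingPairs (c : ChainKind) {n : ℕ} {v : Vertices n} {ξ : Direction}
    {p : Fin n × Fin n} (h : p ∈ crossingPairs v ξ) :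
    Crosses c v ξ (crossingTime v ξ p) (crossingTime v ξ p.swap) := by
  obtain ⟨i, j⟩ := p
  obtain ⟨hD, hs, ht⟩ := h
  simp only [Prod.swap_prod_mk] at hs ht hD ⊢
  refine ⟨edge_add_mem_chainTimes c _ hs.1.le hs.2, edge_add_mem_chainTimes c _ ht.1.le ht.2,
    ?_, ?_⟩
  · intro he
    obtain ⟨hij, -⟩ := edge_add_inj hs.1.le hs.2 ht.1.le ht.2 he
    dsimp only at hij
    subst hij
    apply hD
    unfold tripleProduct
    ring
  · unfold crossingTime
    rw [chainPoint_add v _ (Set.Ioo_subset_Icc_self hs),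
      chainPoint_add v _ (Set.Ioo_subset_Icc_self ht), planeProjection_eq_planeProjection_iff]
    exact ⟨_, (edgePoint_sub_edgePoint_iff hD).2 ⟨rfl, rfl, rfl⟩⟩

theorem IsGeneric.exists_mem_crossingPairs {c : ChainKind} {n : ℕ} {v : Vertices n} {ξ : Direction}
    (hg : IsGeneric c v ξ) {i j : Fin n} {s t : ℝ} (hs : s ∈ Set.Icc (0 : ℝ) 1)
    (ht : t ∈ Set.Icc (0 : ℝ) 1) (h : Crosses c v ξ (i + s) (j + t)) :
    (i, j) ∈ crossingPairs v ξ ∧ s = crossingParam v ξ (i, j) ∧ t = crossingParam v ξ (j, i) := by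
  have key : ∀ (k : Fin n) (r : ℝ), r ∈ Set.Icc (0 : ℝ) 1 → (∀ m : ℕ, (k : ℝ) + r ≠ m) →
      r ∈ Set.Ioo (0 : ℝ) 1 := by
    intro k r hr hk
    refine ⟨lt_of_le_of_ne hr.1 ?_, lt_of_le_of_ne hr.2 ?_⟩
    · rintro rfl
      exact hk k (by simp)
    · rintro rfl
      exact hk (k + 1) (by simp)
  have hs' := key i s hs (hg _ _ h).1
  have ht' := key j t ht (hg _ _ h.symm).1
  have hD := (hg _ _ h).2.1
  rw [planarDet_eq, edgeVector_add v i hs.1 hs'.2, edgeVector_add v j ht.1 ht'.2] at hD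
  have h4 := h.2.2.2
  rw [chainPoint_add v i hs, chainPoint_add v j ht, planeProjection_eq_planeProjection_iff] at h4
  obtain ⟨l, hl⟩ := h4
  obtain ⟨e1, e2, -⟩ := (edgePoint_sub_edgePoint_iff hD).1 hl
  refine ⟨⟨hD, ?_, ?_⟩, e1, e2⟩
  · exact e1 ▸ hs'
  · exact e2 ▸ ht'

/-! ### Transfer of diagrams -/

/-- Both lists are sorted and have the same entries without repetition, so they coincide. -/
theorem sort_toFinset_image {X Y : Set ℝ} (hX : X.Finite) (hY : Y.Finite) {f : ℝ → ℝ}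
    (hf : StrictMonoOn f X) (him : f '' X = Y) :
    hY.toFinset.sort (fun s t : ℝ => s ≤ t) =
      (hX.toFinset.sort (fun s t : ℝ => s ≤ t)).map f := by
  have hmem : ∀ a ∈ hX.toFinset.sort (fun s t : ℝ => s ≤ t), a ∈ X := by
    intro a ha
    simpa using ha
  apply List.Perm.eq_of_pairwise' (r := fun s t : ℝ => s ≤ t)
  · exact Finset.pairwise_sort _ _
  · rw [List.pairwise_map]
    refine (Finset.pairwise_sort hX.toFinset (fun s t : ℝ => s ≤ t)).imp_of_mem ?_
    intro a b ha hb hab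
    exact hf.monotoneOn (hmem a ha) (hmem b hb) hab
  · rw [List.perm_ext_iff_of_nodup (Finset.sort_nodup _ _)
      ((Finset.sort_nodup _ _).map_on fun a ha b hb h => hf.injOn (hmem a ha) (hmem b hb) h)]
    intro a
    simp [← him]

theorem projectionDiagram_eq_of_strictMonoOn {c : ChainKind} {n : ℕ} {v v' : Vertices n}
    {ξ ξ' : Direction} (hX : (crossingTimes c v ξ).Finite) {f : ℝ → ℝ}
    (hf : StrictMonoOn f (crossingTimes c v ξ))
    (him : f '' crossingTimes c v ξ = crossingTimes c v' ξ')
    (hp : ∀ u ∈ crossingTimes c v ξ, passageAt c v' ξ' (f u) = passageAt c v ξ u) :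
    projectionDiagram c v' ξ' = projectionDiagram c v ξ := by
  have hY : (crossingTimes c v' ξ').Finite := him ▸ hX.image f
  unfold projectionDiagram
  rw [dif_pos hX, dif_pos hY, sort_toFinset_image hX hY hf him, List.map_map]
  apply List.map_congr_left
  intro u hu
  exact hp u (by simpa using hu)

theorem IsGeneric.mate_eq {c : ChainKind} {n : ℕ} {v : Vertices n} {ξ : Direction}
    (hg : IsGeneric c v ξ) {u u' : ℝ} (h : Crosses c v ξ u u') : mate c v ξ u = u' := by
  have hex : ∃ u', Crosses c v ξ u u' := ⟨u', h⟩
  unfold mate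
  rw [dif_pos hex]
  exact (hg u u' h).2.2 _ hex.choose_spec

/-- The height of the `i`-th edge over the `j`-th edge at their crossing. -/
noncomputable def crossingHeight {n : ℕ} (v : Vertices n) (ξ : Space3) (p : Fin n × Fin n) : ℝ :=
  -(tripleProduct (edge v p.1) (edge v p.2) (v p.2.castSucc - v p.1.castSucc) /
    tripleProduct (edge v p.1) (edge v p.2) ξ)

theorem height_sub_height {n : ℕ} {v : Vertices n} {ξ : Direction} {p : Fin n × Fin n}
    (h : p ∈ crossingPairs v ξ) :
    height ξ (chainPoint v (crossingTime v ξ p)) -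
      height ξ (chainPoint v (crossingTime v ξ p.swap)) = crossingHeight v ξ p := by
  obtain ⟨hD, hs, ht⟩ := h
  have e : edgePoint v p.1 (crossingParam v ξ p) - edgePoint v p.swap.1 (crossingParam v ξ p.swap)
      = crossingHeight v ξ p • (ξ : Space3) :=
    (edgePoint_sub_edgePoint_iff hD).2 ⟨rfl, rfl, rfl⟩
  unfold crossingTime height
  rw [chainPoint_add v _ (Set.Ioo_subset_Icc_self hs),
    chainPoint_add v _ (Set.Ioo_subset_Icc_self ht), ← inner_sub_right, e, inner_smul_right, inner_direction_self, mul_one]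

/-- Height zero would make two distinct times the same point of space. This is the one place where
the stability argument uses injectivity of the chain. -/
theorem crossingHeight_ne_zero {c : ChainKind} {n : ℕ} {v : Vertices n} (hv : v ∈ chainSpace c n)
    {ξ : Direction} {p : Fin n × Fin n} (h : p ∈ crossingPairs v ξ) :
    crossingHeight v ξ p ≠ 0 := by
  intro h0
  have hc := crosses_of_mem_crossingPairs c h
  obtain ⟨hD, hs, ht⟩ := h
  apply hc.2.2.1
  apply hv.1 hc.1 hc.2.1
  unfold crossingTime
  rw [chainPoint_add v _ (Set.Ioo_subset_Icc_self hs),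
    chainPoint_add v _ (Set.Ioo_subset_Icc_self ht), ← sub_eq_zero]
  have := (edgePoint_sub_edgePoint_iff (l := crossingHeight v ξ p) hD).2 ⟨rfl, rfl, rfl⟩
  rw [h0, zero_smul] at this
  exact this

/-- The crossings of the projection along `ξ` are those of the pairs of edges in `C`; they are
transversal and simple. -/
structure HasCrossingPairs (c : ChainKind) {n : ℕ} (v : Vertices n) (ξ : Direction)
    (C : Set (Fin n × Fin n)) : Prop where
  subset : C ⊆ crossingPairs v ξ
  swap_mem : ∀ p ∈ C, p.swap ∈ C
  injOn : Set.InjOn (crossingTime v ξ) C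
  exists_of_crosses : ∀ u u', Crosses c v ξ u u' →
    ∃ p ∈ C, u = crossingTime v ξ p ∧ u' = crossingTime v ξ p.swap

theorem edgeVector_crossingTime {n : ℕ} {v : Vertices n} {ξ : Space3} {p : Fin n × Fin n}
    (h : p ∈ crossingPairs v ξ) : edgeVector v (crossingTime v ξ p) = edge v p.1 :=
  edgeVector_add v p.1 h.2.1.1.le h.2.1.2

namespace HasCrossingPairs

variable {c : ChainKind} {n : ℕ} {v v' : Vertices n} {ξ ξ' : Direction} {C : Set (Fin n × Fin n)}

theorem isGeneric (h : HasCrossingPairs c v ξ C) : IsGeneric c v ξ := by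
  intro u u' hu
  obtain ⟨p, hp, rfl, rfl⟩ := h.exists_of_crosses u u' hu
  have hp' := h.subset hp
  refine ⟨edge_add_ne_natCast _ hp'.2.1.1 hp'.2.1.2, ?_, ?_⟩
  · rw [planarDet_eq, edgeVector_crossingTime hp',
      edgeVector_crossingTime (swap_mem_crossingPairs hp')]
    exact hp'.1
  · intro u'' hu''
    obtain ⟨q, hq, e, rfl⟩ := h.exists_of_crosses _ u'' hu''
    rw [h.injOn hp hq e]

theorem crossingTimes_eq (h : HasCrossingPairs c v ξ C) :
    crossingTimes c v ξ = crossingTime v ξ '' C := by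
  ext u
  constructor
  · rintro ⟨u', hu⟩
    obtain ⟨p, hp, rfl, -⟩ := h.exists_of_crosses u u' hu
    exact ⟨p, hp, rfl⟩
  · rintro ⟨p, hp, rfl⟩
    exact ⟨_, crosses_of_mem_crossingPairs c (h.subset hp)⟩

theorem mate_crossingTime (h : HasCrossingPairs c v ξ C) {p : Fin n × Fin n} (hp : p ∈ C) :
    mate c v ξ (crossingTime v ξ p) = crossingTime v ξ p.swap :=
  h.isGeneric.mate_eq (crosses_of_mem_crossingPairs c (h.subset hp))

theorem passageAt_crossingTime (h : HasCrossingPairs c v ξ C) {p : Fin n × Fin n} (hp : p ∈ C) :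
    passageAt c v ξ (crossingTime v ξ p) =
      ⟨{t ∈ crossingTimes c v ξ |
          t < min (crossingTime v ξ p) (crossingTime v ξ p.swap)}.ncard,
        decide (0 < crossingHeight v ξ p),
        decide (0 < crossingHeight v ξ p * tripleProduct (edge v p.1) (edge v p.2) ξ)⟩ := by
  have hp' := h.subset hp
  unfold passageAt
  rw [h.mate_crossingTime hp, height_sub_height hp', planarDet_eq, edgeVector_crossingTime hp',
    edgeVector_crossingTime (swap_mem_crossingPairs hp'), ← height_sub_height hp']
  simp only [sub_pos, Prod.fst_swap]

/-- Both configurations have their crossings indexed by the same `C`, so matching the times of equal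
pairs gives an increasing bijection of crossing times. The word only depends on the order of these
times and on the signs that `ho` and `hs` compare. -/
theorem projectionDiagram_eq (h : HasCrossingPairs c v ξ C) (h' : HasCrossingPairs c v' ξ' C)
    (hlt : ∀ p ∈ C, ∀ q ∈ C, crossingTime v ξ p < crossingTime v ξ q →
      crossingTime v' ξ' p < crossingTime v' ξ' q)
    (ho : ∀ p ∈ C, (0 < crossingHeight v' ξ' p ↔ 0 < crossingHeight v ξ p))
    (hs : ∀ p ∈ C,
      (0 < crossingHeight v' ξ' p * tripleProduct (edge v' p.1) (edge v' p.2) ξ' ↔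
        0 < crossingHeight v ξ p * tripleProduct (edge v p.1) (edge v p.2) ξ)) :
    projectionDiagram c v' ξ' = projectionDiagram c v ξ := by
  -- The chosen pair is unique because crossing times are injective on `C`; the default value `u` is
  -- taken only off the crossing times and plays no role.
  let f : ℝ → ℝ := fun u =>
    if hu : ∃ p ∈ C, crossingTime v ξ p = u then crossingTime v' ξ' hu.choose else u
  have hf : ∀ p ∈ C, f (crossingTime v ξ p) = crossingTime v' ξ' p := by
    intro p hp
    have hu : ∃ q ∈ C, crossingTime v ξ q = crossingTime v ξ p := ⟨p, hp, rfl⟩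
    simp only [f]
    rw [dif_pos hu, h.injOn hu.choose_spec.1 hp hu.choose_spec.2]
  have hmono : StrictMonoOn f (crossingTimes c v ξ) := by
    rw [h.crossingTimes_eq]
    rintro _ ⟨p, hp, rfl⟩ _ ⟨q, hq, rfl⟩ hpq
    rw [hf p hp, hf q hq]
    exact hlt p hp q hq hpq
  have him : f '' crossingTimes c v ξ = crossingTimes c v' ξ' := by
    rw [h.crossingTimes_eq, h'.crossingTimes_eq, Set.image_image]
    exact Set.image_congr hf
  have hfin : (crossingTimes c v ξ).Finite := by
    rw [h.crossingTimes_eq]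
    exact (Set.toFinite C).image _
  refine projectionDiagram_eq_of_strictMonoOn hfin hmono him ?_
  intro u hu
  rw [h.crossingTimes_eq] at hu
  obtain ⟨p, hp, rfl⟩ := hu
  have hp1 : crossingTime v ξ p ∈ crossingTimes c v ξ := by
    rw [h.crossingTimes_eq]; exact ⟨p, hp, rfl⟩
  have hp2 : crossingTime v ξ p.swap ∈ crossingTimes c v ξ := by
    rw [h.crossingTimes_eq]; exact ⟨_, h.swap_mem p hp, rfl⟩
  rw [hf p hp, h.passageAt_crossingTime hp, h'.passageAt_crossingTime hp]
  -- A label counts the crossing times before the first passage, and the increasing bijection `f`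
  -- preserves this count.
  have e3 : {t ∈ crossingTimes c v' ξ' |
        t < min (crossingTime v' ξ' p) (crossingTime v' ξ' p.swap)}.ncard =
      {t ∈ crossingTimes c v ξ |
        t < min (crossingTime v ξ p) (crossingTime v ξ p.swap)}.ncard := by
    rw [← Set.InjOn.ncard_image (f := f)
      (s := {t ∈ crossingTimes c v ξ |
        t < min (crossingTime v ξ p) (crossingTime v ξ p.swap)})
      (hmono.injOn.mono (Set.sep_subset _ _))]
    congr 1
    rw [← him]
    ext t
    simp only [Set.mem_ofPred_eq, Set.mem_image, lt_min_iff]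
    constructor
    · rintro ⟨⟨r, hr, rfl⟩, h1, h2⟩
      rw [← hf p hp, hmono.lt_iff_lt hr hp1] at h1
      rw [← hf _ (h.swap_mem p hp), hmono.lt_iff_lt hr hp2] at h2
      exact ⟨r, ⟨hr, h1, h2⟩, rfl⟩
    · rintro ⟨r, ⟨hr, h1, h2⟩, rfl⟩
      refine ⟨⟨r, hr, rfl⟩, ?_, ?_⟩
      · rw [← hf p hp]; exact hmono hr hp1 h1
      · rw [← hf _ (h.swap_mem p hp)]; exact hmono hr hp2 h2
  rw [e3]
  simp only [ho p hp, hs p hp]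

end HasCrossingPairs

/-- Equal times lie on the same first edge, and uniqueness of the partner time at a double point
forces the second edges to agree. -/
theorem IsGeneric.injOn_crossingTime {c : ChainKind} {n : ℕ} {v : Vertices n} {ξ : Direction}
    (hg : IsGeneric c v ξ) : Set.InjOn (crossingTime v ξ) (crossingPairs v ξ) := by
  intro p hp q hq h
  have hp' := crosses_of_mem_crossingPairs c hp
  rw [h] at hp'
  have h2 := (hg _ _ (crosses_of_mem_crossingPairs c hq)).2.2 _ hp'
  obtain ⟨e1, -⟩ := edge_add_inj hp.2.1.1.le hp.2.1.2 hq.2.1.1.le hq.2.1.2 h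
  obtain ⟨e2, -⟩ := edge_add_inj hp.2.2.1.le hp.2.2.2 hq.2.2.1.le hq.2.2.2 h2
  exact Prod.ext e1 e2

theorem IsGeneric.hasCrossingPairs {c : ChainKind} {n : ℕ} {v : Vertices n} {ξ : Direction}
    (hg : IsGeneric c v ξ) : HasCrossingPairs c v ξ (crossingPairs v ξ) where
  subset := subset_rfl
  swap_mem _ hp := swap_mem_crossingPairs hp
  injOn := hg.injOn_crossingTime
  exists_of_crosses u u' h := by
    have hu := chainTimes_subset c n h.1
    have hu' := chainTimes_subset c n h.2.1
    have hn := h.pos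
    obtain ⟨i, s, hs, rfl⟩ := exists_edge_of_le hn hu.1 hu.2
    obtain ⟨j, t, ht, rfl⟩ := exists_edge_of_le hn hu'.1 hu'.2
    obtain ⟨hC, e1, e2⟩ := hg.exists_mem_crossingPairs hs ht h
    exact ⟨(i, j), hC, by rw [e1]; rfl, by rw [e2]; rfl⟩

/-! ### Stability of the diagram -/

open Filter Topology

theorem planeProjection_continuous {X : Type*} [TopologicalSpace X] {f : X → Direction}
    {g : X → Space3} (hf : Continuous f) (hg : Continuous g) :
    Continuous fun x => planeProjection (f x) (g x) := by
  simp only [planeProjection_eq]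
  have : Continuous fun x => (f x : Space3) := continuous_subtype_val.comp hf
  fun_prop

theorem planeProjection_eq_zero_iff {ξ : Direction} {x : Space3} :
    planeProjection ξ x = 0 ↔ ∃ l : ℝ, x = l • (ξ : Space3) := by
  have h := planeProjection_eq_planeProjection_iff (ξ := ξ) (x := x) (y := 0)
  rw [sub_zero] at h
  rw [← h]
  simp [planeProjection_eq]

theorem IsGeneric.planeProjection_edge_ne_zero {c : ChainKind} {n : ℕ} {v : Vertices n}
    {ξ : Direction} (hg : IsGeneric c v ξ) (i : Fin n) : planeProjection ξ (edge v i) ≠ 0 := by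
  intro h
  obtain ⟨l, hl⟩ := planeProjection_eq_zero_iff.1 h
  have hc : Crosses c v ξ (i + (0 : ℝ)) (i + (1 / 2 : ℝ)) := by
    refine ⟨edge_add_mem_chainTimes c i le_rfl zero_lt_one,
      edge_add_mem_chainTimes c i (by norm_num) (by norm_num), by norm_num, ?_⟩
    rw [chainPoint_add v i (by norm_num), chainPoint_add v i (by norm_num),
      planeProjection_eq_planeProjection_iff]
    refine ⟨-(l / 2), ?_⟩
    unfold edgePoint
    rw [hl]
    module
  exact (hg _ _ hc).1 i (by simp)

/-- If a convex combination of two consecutive edge vectors were parallel to `ξ`, the projected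
chain would fold back on itself at the common vertex, and the two edges would cross without
transversality. -/
theorem IsGeneric.planeProjection_combination_ne_zero {c : ChainKind} {n : ℕ} {v : Vertices n}
    {ξ : Direction} (hg : IsGeneric c v ξ) {i j : Fin n} (hv : v i.succ = v j.castSucc) {r : ℝ}
    (hr : r ∈ Set.Icc (0 : ℝ) 1) :
    planeProjection ξ (r • edge v i + (1 - r) • edge v j) ≠ 0 := by
  rcases hr.1.eq_or_lt with rfl | h0
  · simpa using hg.planeProjection_edge_ne_zero j
  rcases hr.2.eq_or_lt with rfl | h1
  · simpa using hg.planeProjection_edge_ne_zero i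
  intro h
  obtain ⟨l, hl⟩ := planeProjection_eq_zero_iff.1 h
  -- Moving back by `r / 2` on edge `i` and forward by `(1 - r) / 2` on edge `j` gives points whose
  -- difference is a multiple of the vertical combination; the factor one half keeps both off the
  -- endpoints.
  have hs : (1 - r / 2) ∈ Set.Ioo (0 : ℝ) 1 := ⟨by linarith, by linarith⟩
  have ht : ((1 - r) / 2) ∈ Set.Ioo (0 : ℝ) 1 := ⟨by linarith, by linarith⟩
  have hc : Crosses c v ξ (i + (1 - r / 2)) (j + ((1 - r) / 2)) := by
    refine ⟨edge_add_mem_chainTimes c i hs.1.le hs.2, edge_add_mem_chainTimes c j ht.1.le ht.2,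
      ?_, ?_⟩
    · intro he
      have := (edge_add_inj hs.1.le hs.2 ht.1.le ht.2 he).2
      linarith
    · rw [chainPoint_add v i (Set.Ioo_subset_Icc_self hs),
        chainPoint_add v j (Set.Ioo_subset_Icc_self ht), planeProjection_eq_planeProjection_iff]
      refine ⟨-(l / 2), ?_⟩
      have e : edgePoint v i (1 - r / 2) - edgePoint v j ((1 - r) / 2) =
          (-(1 / 2 : ℝ)) • (r • edge v i + (1 - r) • edge v j) := by
        have : v i.castSucc = v j.castSucc - edge v i := by rw [← hv, edge]; abel
        unfold edgePoint
        rw [this]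
        module
      rw [e, hl]
      module
  apply (hg _ _ hc).2.1
  rw [edgeVector_add v i hs.1.le hs.2, edgeVector_add v j ht.1.le ht.2, planarDet_eq]
  have e : r * tripleProduct (edge v i) (edge v j) ξ =
      tripleProduct (r • edge v i + (1 - r) • edge v j) (edge v j) ξ := by
    simp [tripleProduct]
    ring
  rw [hl] at e
  have e2 : tripleProduct (l • (ξ : Space3)) (edge v j) ξ = 0 := by
    simp [tripleProduct]
    ring
  rw [e2] at e
  exact (mul_eq_zero.1 e).resolve_left h0.ne'

/-! ### Persistence of crossings near a generic configuration -/

section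

variable {c : ChainKind} {n : ℕ} {x₀ : chainSpace c n × Direction}

theorem edge_continuous_config (i : Fin n) :
    Continuous fun x : chainSpace c n × Direction => edge (x.1 : Vertices n) i :=
  (edge_continuous i).comp (continuous_subtype_val.comp continuous_fst)

theorem vertex_continuous_config (k : Fin (n + 1)) :
    Continuous fun x : chainSpace c n × Direction => (x.1 : Vertices n) k :=
  (continuous_apply k).comp (continuous_subtype_val.comp continuous_fst)

theorem direction_continuous_config :
    Continuous fun x : chainSpace c n × Direction => (x.2 : Space3) :=
  continuous_subtype_val.comp continuous_snd

theorem edgePoint_continuous_config (i : Fin n) :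
    Continuous fun z : (chainSpace c n × Direction) × ℝ => edgePoint (z.1.1 : Vertices n) i z.2 :=
  ((vertex_continuous_config _).comp continuous_fst).add
    (continuous_snd.smul ((edge_continuous_config i).comp continuous_fst))

theorem tripleProduct_edge_continuous_config (i j : Fin n) :
    Continuous fun x : chainSpace c n × Direction =>
      tripleProduct (edge (x.1 : Vertices n) i) (edge (x.1 : Vertices n) j) x.2 :=
  tripleProduct_continuous (edge_continuous_config i) (edge_continuous_config j)
    direction_continuous_config

theorem eventually_edge_not_vertical (hg : IsGeneric c (x₀.1 : Vertices n) x₀.2) (i : Fin n) :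
    ∀ᶠ x : chainSpace c n × Direction in 𝓝 x₀, ∀ s t : ℝ,
      planeProjection x.2 (edgePoint (x.1 : Vertices n) i s) =
        planeProjection x.2 (edgePoint (x.1 : Vertices n) i t) → s = t := by
  have hc : Continuous fun x : chainSpace c n × Direction =>
      planeProjection x.2 (edge (x.1 : Vertices n) i) :=
    planeProjection_continuous continuous_snd (edge_continuous_config i)
  filter_upwards [hc.continuousAt.eventually_ne (hg.planeProjection_edge_ne_zero i)] with x hx s t h
  rw [planeProjection_eq_planeProjection_iff] at h
  obtain ⟨l, hl⟩ := h
  by_contra hst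
  apply hx
  rw [planeProjection_eq_zero_iff]
  refine ⟨(s - t)⁻¹ * l, ?_⟩
  rw [mul_smul, ← hl, edgePoint, edgePoint, add_sub_add_left_eq_sub, ← sub_smul, smul_smul,
    inv_mul_cancel₀ (sub_ne_zero.2 hst), one_smul]

/-- The common vertex is always a coincidence at `(1, 0)`, so plain compactness in `(s, t)` fails.
Dividing the difference of the two points by `(1 - s) + t` turns it, up to sign, into a convex
combination of the edge vectors, and compactness in the weight `r` keeps these combinations
uniformly non-vertical. -/
theorem eventually_adjacent_edges (hg : IsGeneric c (x₀.1 : Vertices n) x₀.2) {i j : Fin n}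
    (hij : ∀ v ∈ chainSpace c n, v i.succ = v j.castSucc) :
    ∀ᶠ x : chainSpace c n × Direction in 𝓝 x₀, ∀ s ∈ Set.Icc (0 : ℝ) 1, ∀ t ∈ Set.Icc (0 : ℝ) 1,
      planeProjection x.2 (edgePoint (x.1 : Vertices n) i s) =
        planeProjection x.2 (edgePoint (x.1 : Vertices n) j t) → s = 1 ∧ t = 0 := by
  have hc : Continuous fun z : (chainSpace c n × Direction) × ℝ =>
      planeProjection z.1.2
        (z.2 • edge (z.1.1 : Vertices n) i + (1 - z.2) • edge (z.1.1 : Vertices n) j) := by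
    refine planeProjection_continuous (continuous_snd.comp continuous_fst) ?_
    have h1 := (edge_continuous_config (c := c) i).comp (continuous_fst (Y := ℝ))
    have h2 := (edge_continuous_config (c := c) j).comp (continuous_fst (Y := ℝ))
    exact (continuous_snd.smul h1).add ((continuous_const.sub continuous_snd).smul h2)
  have h := (isCompact_Icc (a := (0 : ℝ)) (b := 1)).eventually_forall_of_forall_eventually
    (x₀ := x₀) (P := fun x r => r ∈ Set.Icc (0 : ℝ) 1 → planeProjection x.2
        (r • edge (x.1 : Vertices n) i + (1 - r) • edge (x.1 : Vertices n) j) ≠ 0) (by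
      intro r hr
      filter_upwards [(hc.continuousAt (x := (x₀, r))).eventually_ne
        (hg.planeProjection_combination_ne_zero (hij _ x₀.1.2) hr)] with z hz _
      exact hz)
  filter_upwards [h] with x hx s hs t ht hst
  by_contra hne
  have hpos : 0 < (1 - s) + t := by
    rcases hs.2.lt_or_eq with h1 | h1
    · linarith [ht.1]
    · rcases ht.1.lt_or_eq with h2 | h2
      · linarith
      · exact absurd ⟨h1, h2.symm⟩ hne
  have hr : (1 - s) / ((1 - s) + t) ∈ Set.Icc (0 : ℝ) 1 :=
    ⟨div_nonneg (by linarith [hs.2]) hpos.le, (div_le_one hpos).2 (by linarith [ht.1])⟩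
  apply hx _ hr hr
  obtain ⟨l, hl⟩ := planeProjection_eq_planeProjection_iff.1 hst
  rw [planeProjection_eq_zero_iff]
  refine ⟨-(((1 - s) + t)⁻¹ * l), ?_⟩
  have e : edgePoint (x.1 : Vertices n) i s - edgePoint (x.1 : Vertices n) j t =
      -((1 - s) • edge (x.1 : Vertices n) i + t • edge (x.1 : Vertices n) j) := by
    have : (x.1 : Vertices n) i.castSucc =
        (x.1 : Vertices n) j.castSucc - edge (x.1 : Vertices n) i := by
      rw [← hij _ x.1.2, edge]; abel
    unfold edgePoint
    rw [this]
    module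
  have e1 : 1 - (1 - s) / ((1 - s) + t) = ((1 - s) + t)⁻¹ * t := by
    field_simp
    ring
  rw [neg_smul, mul_smul, ← hl, e, e1, div_eq_inv_mul]
  module

/-- Near `x₀`, the crossings of the `i`-th edge with the `j`-th one are those at `x₀`. -/
def CrossingsPersist (x₀ : chainSpace c n × Direction) (i j : Fin n) : Prop :=
  ∀ᶠ x : chainSpace c n × Direction in 𝓝 x₀, ∀ s ∈ Set.Icc (0 : ℝ) 1, ∀ t ∈ Set.Icc (0 : ℝ) 1,
    Crosses c (x.1 : Vertices n) x.2 (i + s) (j + t) →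
      (i, j) ∈ crossingPairs (x₀.1 : Vertices n) x₀.2 ∧
        s = crossingParam (x.1 : Vertices n) x.2 (i, j) ∧
        t = crossingParam (x.1 : Vertices n) x.2 (j, i)

theorem CrossingsPersist.symm {i j : Fin n} (h : CrossingsPersist x₀ i j) :
    CrossingsPersist x₀ j i := by
  filter_upwards [h] with x hx s hs t ht hc
  obtain ⟨h1, h2, h3⟩ := hx t ht s hs hc.symm
  exact ⟨swap_mem_crossingPairs h1, h3, h2⟩

theorem crossingsPersist_self (hg : IsGeneric c (x₀.1 : Vertices n) x₀.2) (i : Fin n) :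
    CrossingsPersist x₀ i i := by
  filter_upwards [eventually_edge_not_vertical hg i] with x hx s hs t ht hc
  have h := hc.2.2.2
  rw [chainPoint_add _ i hs, chainPoint_add _ i ht] at h
  exact absurd (by rw [hx s t h]) hc.2.2.1

/-- Only the shared vertex can coincide with itself. That is no crossing: either both times are
equal, or the first is time `n`, absent from a closed chain. -/
theorem crossingsPersist_of_adjacent (hg : IsGeneric c (x₀.1 : Vertices n) x₀.2) {i j : Fin n}
    (hij : ∀ v ∈ chainSpace c n, v i.succ = v j.castSucc)
    (htimes : (i : ℝ) + 1 = j ∨ (i : ℝ) + 1 ∉ chainTimes c n) :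
    CrossingsPersist x₀ i j := by
  filter_upwards [eventually_adjacent_edges hg hij] with x hx s hs t ht hc
  have h := hc.2.2.2
  rw [chainPoint_add _ i hs, chainPoint_add _ j ht] at h
  obtain ⟨rfl, rfl⟩ := hx s hs t ht h
  rcases htimes with h1 | h1
  · exact absurd (by rw [h1, add_zero]) hc.2.2.1
  · exact absurd hc.1 h1

/-- The end of the last edge of a closed chain falls at the excluded time `n`; it is reached at time
`0` instead. -/
theorem exists_time_of_edgePoint {v : Vertices n} (hv : v ∈ chainSpace c n) (i : Fin n) {s : ℝ}
    (hs : s ∈ Set.Icc (0 : ℝ) 1) :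
    ∃ u ∈ chainTimes c n, chainPoint v u = edgePoint v i s ∧
      (u = i + s ∨ c = ChainKind.closed ∧ (i : ℝ) + s = n ∧ u = 0) := by
  by_cases h : (i : ℝ) + s ∈ chainTimes c n
  · exact ⟨_, h, chainPoint_add v i hs, Or.inl rfl⟩
  have hi : ((i : ℕ) : ℝ) + 1 ≤ n := by exact_mod_cast i.isLt
  have h0 : (0 : ℝ) ≤ (i : ℝ) + s := add_nonneg (by positivity) hs.1
  have hlt : ¬ (i : ℝ) + s < n := fun hlt => h (mem_chainTimes_of_lt c h0 hlt)
  have he : (i : ℝ) + s = n := by linarith [hs.2]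
  cases c
  · exact absurd ⟨h0, he.le⟩ h
  · have hn : 0 < n := i.pos
    refine ⟨0, ⟨le_rfl, by exact_mod_cast hn⟩, ?_, Or.inr ⟨rfl, he, rfl⟩⟩
    have e0 := chainPoint_natCast v 0
    have en := chainPoint_natCast v (Fin.last n)
    simp only [Fin.val_zero, Nat.cast_zero, Fin.val_last] at e0 en
    rw [← chainPoint_add v i hs, he, e0, en, hv.2 rfl]

/-- Compactness over the parameter square: at each parameter pair the two projections either differ,
which is stable, or form a crossing of `x₀`. Such a crossing is transversal, so Cramer's rule
locates every nearby one. -/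
theorem crossingsPersist_of_not_adjacent (hg : IsGeneric c (x₀.1 : Vertices n) x₀.2) {i j : Fin n}
    (hij : i ≠ j) (h1 : (i : ℕ) + 1 ≠ j) (h2 : (j : ℕ) + 1 ≠ i)
    (h3 : ¬ (c = ChainKind.closed ∧ (i : ℕ) + 1 = n ∧ (j : ℕ) = 0))
    (h4 : ¬ (c = ChainKind.closed ∧ (j : ℕ) + 1 = n ∧ (i : ℕ) = 0)) :
    CrossingsPersist x₀ i j := by
  have hci : Continuous fun z : (chainSpace c n × Direction) × (ℝ × ℝ) =>
      planeProjection z.1.2 (edgePoint (z.1.1 : Vertices n) i z.2.1) := by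
    refine planeProjection_continuous (continuous_snd.comp continuous_fst) ?_
    exact (edgePoint_continuous_config i).comp
      (continuous_fst.prodMk (continuous_fst.comp continuous_snd))
  have hcj : Continuous fun z : (chainSpace c n × Direction) × (ℝ × ℝ) =>
      planeProjection z.1.2 (edgePoint (z.1.1 : Vertices n) j z.2.2) := by
    refine planeProjection_continuous (continuous_snd.comp continuous_fst) ?_
    exact (edgePoint_continuous_config j).comp
      (continuous_fst.prodMk (continuous_snd.comp continuous_snd))
  -- Membership in the square is part of the predicate, because neighbouring parameters may leave
  -- it, and there the edge line no longer follows the chain.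
  have key := ((isCompact_Icc (a := (0 : ℝ)) (b := 1)).prod
    (isCompact_Icc (a := (0 : ℝ)) (b := 1))).eventually_forall_of_forall_eventually
    (x₀ := x₀) (P := fun x (r : ℝ × ℝ) => r.1 ∈ Set.Icc (0 : ℝ) 1 → r.2 ∈ Set.Icc (0 : ℝ) 1 →
      Crosses c (x.1 : Vertices n) x.2 (i + r.1) (j + r.2) →
      (i, j) ∈ crossingPairs (x₀.1 : Vertices n) x₀.2 ∧
        r.1 = crossingParam (x.1 : Vertices n) x.2 (i, j) ∧
        r.2 = crossingParam (x.1 : Vertices n) x.2 (j, i)) ?_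
  · filter_upwards [key] with x hx s hs t ht hc
    exact hx (s, t) ⟨hs, ht⟩ hs ht hc
  rintro ⟨s₀, t₀⟩ ⟨hs₀, ht₀⟩
  dsimp only at hs₀ ht₀
  by_cases hp : planeProjection x₀.2 (edgePoint (x₀.1 : Vertices n) i s₀) =
      planeProjection x₀.2 (edgePoint (x₀.1 : Vertices n) j t₀)
  · obtain ⟨u, hu, eu, hu'⟩ := exists_time_of_edgePoint x₀.1.2 i hs₀
    obtain ⟨w, hw, ew, hw'⟩ := exists_time_of_edgePoint x₀.1.2 j ht₀
    have hne : (i : ℝ) + s₀ ≠ j + t₀ := by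
      intro he
      have a1 : (i : ℕ) ≤ j + 1 := by
        exact_mod_cast (show ((i : ℕ) : ℝ) ≤ j + 1 by linarith [hs₀.1, ht₀.2])
      have a2 : (j : ℕ) ≤ i + 1 := by
        exact_mod_cast (show ((j : ℕ) : ℝ) ≤ i + 1 by linarith [ht₀.1, hs₀.2])
      have a3 : (i : ℕ) ≠ j := fun h => hij (Fin.ext h)
      omega
    have hwrap : ∀ (a b : Fin n) (s t : ℝ), s ∈ Set.Icc (0 : ℝ) 1 → t ∈ Set.Icc (0 : ℝ) 1 →
        (a : ℝ) + s = n → (b : ℝ) + t = 0 → (a : ℕ) + 1 = n ∧ (b : ℕ) = 0 := by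
      intro a b s t hs ht e1 e2
      have a1 : n ≤ (a : ℕ) + 1 := by
        exact_mod_cast (show (n : ℝ) ≤ (a : ℕ) + 1 by linarith [hs.2])
      have a2 : ((b : ℕ) : ℝ) ≤ 0 := by linarith [ht.1]
      have a3 : (b : ℕ) ≤ 0 := by exact_mod_cast a2
      have := a.isLt
      omega
    have huw : u ≠ w := by
      rintro rfl
      rcases hu' with e1 | ⟨hc, e1, e1'⟩
      · rcases hw' with e2 | ⟨hc, e2, e2'⟩
        · exact hne (e1 ▸ e2)
        · exact h4 ⟨hc, hwrap j i t₀ s₀ ht₀ hs₀ e2 (e1 ▸ e2')⟩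
      · rcases hw' with e2 | ⟨hc, e2, e2'⟩
        · exact h3 ⟨hc, hwrap i j s₀ t₀ hs₀ ht₀ e1 (e2 ▸ e1')⟩
        · exact hne (e1.trans e2.symm)
    have hcr : Crosses c (x₀.1 : Vertices n) x₀.2 u w := ⟨hu, hw, huw, by rw [eu, ew]; exact hp⟩
    -- A time wrapped to `0` would put a vertex at a crossing, which genericity forbids.
    rcases hu' with rfl | ⟨-, -, rfl⟩
    swap
    · exact absurd Nat.cast_zero.symm ((hg _ _ hcr).1 0)
    rcases hw' with rfl | ⟨-, -, rfl⟩
    swap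
    · exact absurd Nat.cast_zero.symm ((hg _ _ hcr.symm).1 0)
    have hC := (hg.exists_mem_crossingPairs hs₀ ht₀ hcr).1
    have hD := ((tripleProduct_edge_continuous_config (c := c) i j).comp
      (continuous_fst (Y := ℝ × ℝ))).continuousAt (x := (x₀, (s₀, t₀))) |>.eventually_ne hC.1
    filter_upwards [hD] with z hz hs ht hc
    have h := hc.2.2.2
    rw [chainPoint_add _ i hs, chainPoint_add _ j ht, planeProjection_eq_planeProjection_iff] at h
    obtain ⟨l, hl⟩ := h
    obtain ⟨e1, e2, -⟩ := (edgePoint_sub_edgePoint_iff hz).1 hl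
    exact ⟨hC, e1, e2⟩
  · have hev : ∀ᶠ z : (chainSpace c n × Direction) × (ℝ × ℝ) in 𝓝 (x₀, (s₀, t₀)),
        planeProjection z.1.2 (edgePoint (z.1.1 : Vertices n) i z.2.1) ≠
          planeProjection z.1.2 (edgePoint (z.1.1 : Vertices n) j z.2.2) :=
      (isOpen_ne_fun hci hcj).mem_nhds hp
    filter_upwards [hev] with z hz hs ht hc
    have h := hc.2.2.2
    rw [chainPoint_add _ i hs, chainPoint_add _ j ht] at h
    exact absurd h hz

theorem crossingsPersist (hg : IsGeneric c (x₀.1 : Vertices n) x₀.2) (i j : Fin n) :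
    CrossingsPersist x₀ i j := by
  have hnext : ∀ {i j : Fin n}, (i : ℕ) + 1 = j → CrossingsPersist x₀ i j := by
    intro i j h
    refine crossingsPersist_of_adjacent hg (fun v _ => ?_) (Or.inl (by exact_mod_cast h))
    congr 1
    ext
    simpa using h
  have hwrap : ∀ {i j : Fin n}, c = ChainKind.closed ∧ (i : ℕ) + 1 = n ∧ (j : ℕ) = 0 →
      CrossingsPersist x₀ i j := by
    rintro i j ⟨hc, hi, hj⟩
    refine crossingsPersist_of_adjacent hg (fun v hv => ?_) (Or.inr ?_)
    · have e1 : i.succ = Fin.last n := by ext; simpa using hi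
      have e2 : j.castSucc = 0 := by ext; simpa using hj
      rw [e1, e2, hv.2 hc]
    · subst hc
      intro hmem
      have h1 : ((i : ℕ) : ℝ) + 1 = n := by exact_mod_cast hi
      exact absurd hmem.2 (not_lt.2 h1.ge)
  by_cases h0 : i = j
  · subst h0
    exact crossingsPersist_self hg i
  by_cases h1 : (i : ℕ) + 1 = j
  · exact hnext h1
  by_cases h2 : (j : ℕ) + 1 = i
  · exact (hnext h2).symm
  by_cases h3 : c = ChainKind.closed ∧ (i : ℕ) + 1 = n ∧ (j : ℕ) = 0
  · exact hwrap h3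
  by_cases h4 : c = ChainKind.closed ∧ (j : ℕ) + 1 = n ∧ (i : ℕ) = 0
  · exact (hwrap h4).symm
  exact crossingsPersist_of_not_adjacent hg h0 h1 h2 h3 h4

end

/-! ### Continuity of the crossing data and local constancy of the diagram -/

section

variable {c : ChainKind} {n : ℕ} {x₀ : chainSpace c n × Direction}

theorem crossingParam_continuousAt {p : Fin n × Fin n}
    (hp : tripleProduct (edge (x₀.1 : Vertices n) p.1) (edge (x₀.1 : Vertices n) p.2) x₀.2 ≠ 0) :
    ContinuousAt (fun x : chainSpace c n × Direction =>
      crossingParam (x.1 : Vertices n) x.2 p) x₀ := by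
  refine ContinuousAt.div (Continuous.continuousAt ?_)
    (tripleProduct_edge_continuous_config p.1 p.2).continuousAt hp
  exact tripleProduct_continuous
    ((vertex_continuous_config _).sub (vertex_continuous_config _)) (edge_continuous_config _)
    direction_continuous_config

theorem crossingTime_continuousAt {p : Fin n × Fin n}
    (hp : tripleProduct (edge (x₀.1 : Vertices n) p.1) (edge (x₀.1 : Vertices n) p.2) x₀.2 ≠ 0) :
    ContinuousAt (fun x : chainSpace c n × Direction =>
      crossingTime (x.1 : Vertices n) x.2 p) x₀ :=
  continuousAt_const.add (crossingParam_continuousAt hp)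

theorem crossingHeight_continuousAt {p : Fin n × Fin n}
    (hp : tripleProduct (edge (x₀.1 : Vertices n) p.1) (edge (x₀.1 : Vertices n) p.2) x₀.2 ≠ 0) :
    ContinuousAt (fun x : chainSpace c n × Direction =>
      crossingHeight (x.1 : Vertices n) x.2 p) x₀ := by
  refine (ContinuousAt.div (Continuous.continuousAt ?_)
    (tripleProduct_edge_continuous_config p.1 p.2).continuousAt hp).neg
  exact tripleProduct_continuous (edge_continuous_config _) (edge_continuous_config _)
    ((vertex_continuous_config _).sub (vertex_continuous_config _))

theorem eventually_pos_iff {X : Type*} [TopologicalSpace X] {f : X → ℝ} {x₀ : X}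
    (hf : ContinuousAt f x₀) (h : f x₀ ≠ 0) : ∀ᶠ x in 𝓝 x₀, (0 < f x ↔ 0 < f x₀) := by
  rcases lt_or_gt_of_ne h with h | h
  · filter_upwards [hf.eventually_lt_const h] with x hx
    exact iff_of_false hx.not_gt h.not_gt
  · filter_upwards [hf.eventually_const_lt h] with x hx
    exact iff_of_true hx h

theorem eventually_mem_crossingPairs {p : Fin n × Fin n}
    (hp : p ∈ crossingPairs (x₀.1 : Vertices n) x₀.2) :
    ∀ᶠ x : chainSpace c n × Direction in 𝓝 x₀, p ∈ crossingPairs (x.1 : Vertices n) x.2 := by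
  have hp' := (swap_mem_crossingPairs hp).1
  filter_upwards [(tripleProduct_edge_continuous_config p.1 p.2).continuousAt.eventually_ne hp.1,
    crossingParam_continuousAt hp.1 |>.eventually_mem (isOpen_Ioo.mem_nhds hp.2.1),
    crossingParam_continuousAt hp' |>.eventually_mem (isOpen_Ioo.mem_nhds hp.2.2)]
    with x h1 h2 h3
  exact ⟨h1, h2, h3⟩

/-- The diagram of a generic projection of a simple chain does not change under small perturbations
of the chain and of the direction. -/
theorem eventually_isGeneric_and_projectionDiagram_eq
    (hg : IsGeneric c (x₀.1 : Vertices n) x₀.2) :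
    ∀ᶠ x : chainSpace c n × Direction in 𝓝 x₀, IsGeneric c (x.1 : Vertices n) x.2 ∧
      projectionDiagram c (x.1 : Vertices n) x.2 =
        projectionDiagram c (x₀.1 : Vertices n) x₀.2 := by
  set C := crossingPairs (x₀.1 : Vertices n) x₀.2 with hCdef
  have h₀ : HasCrossingPairs c (x₀.1 : Vertices n) x₀.2 C := hg.hasCrossingPairs
  have hsub : ∀ᶠ x : chainSpace c n × Direction in 𝓝 x₀, ∀ p ∈ C,
      p ∈ crossingPairs (x.1 : Vertices n) x.2 :=
    (eventually_all_finite (Set.toFinite C)).2 fun p hp => eventually_mem_crossingPairs hp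
  have hlt : ∀ᶠ x : chainSpace c n × Direction in 𝓝 x₀, ∀ p ∈ C, ∀ q ∈ C,
      crossingTime (x₀.1 : Vertices n) x₀.2 p < crossingTime (x₀.1 : Vertices n) x₀.2 q →
      crossingTime (x.1 : Vertices n) x.2 p < crossingTime (x.1 : Vertices n) x.2 q := by
    refine (eventually_all_finite (Set.toFinite C)).2 fun p hp =>
      (eventually_all_finite (Set.toFinite C)).2 fun q hq => ?_
    rw [eventually_imp_distrib_left]
    intro h
    exact (crossingTime_continuousAt hp.1).eventually_lt (crossingTime_continuousAt hq.1) h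
  have ho : ∀ᶠ x : chainSpace c n × Direction in 𝓝 x₀, ∀ p ∈ C,
      (0 < crossingHeight (x.1 : Vertices n) x.2 p ↔
        0 < crossingHeight (x₀.1 : Vertices n) x₀.2 p) :=
    (eventually_all_finite (Set.toFinite C)).2 fun p hp =>
      eventually_pos_iff (crossingHeight_continuousAt hp.1) (crossingHeight_ne_zero x₀.1.2 hp)
  have hs : ∀ᶠ x : chainSpace c n × Direction in 𝓝 x₀, ∀ p ∈ C,
      (0 < crossingHeight (x.1 : Vertices n) x.2 p *
          tripleProduct (edge (x.1 : Vertices n) p.1) (edge (x.1 : Vertices n) p.2) x.2 ↔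
        0 < crossingHeight (x₀.1 : Vertices n) x₀.2 p *
          tripleProduct (edge (x₀.1 : Vertices n) p.1) (edge (x₀.1 : Vertices n) p.2) x₀.2) :=
    (eventually_all_finite (Set.toFinite C)).2 fun p hp =>
      eventually_pos_iff (f := fun x : chainSpace c n × Direction =>
        crossingHeight (x.1 : Vertices n) x.2 p *
          tripleProduct (edge (x.1 : Vertices n) p.1) (edge (x.1 : Vertices n) p.2) x.2)
        ((crossingHeight_continuousAt hp.1).mul
          (tripleProduct_edge_continuous_config p.1 p.2).continuousAt)
        (mul_ne_zero (crossingHeight_ne_zero x₀.1.2 hp) hp.1)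
  have hcr : ∀ᶠ x : chainSpace c n × Direction in 𝓝 x₀, ∀ i j : Fin n,
      ∀ s ∈ Set.Icc (0 : ℝ) 1, ∀ t ∈ Set.Icc (0 : ℝ) 1,
      Crosses c (x.1 : Vertices n) x.2 (i + s) (j + t) →
        (i, j) ∈ C ∧ s = crossingParam (x.1 : Vertices n) x.2 (i, j) ∧
          t = crossingParam (x.1 : Vertices n) x.2 (j, i) :=
    eventually_all.2 fun i => eventually_all.2 fun j => crossingsPersist hg i j
  filter_upwards [hsub, hlt, ho, hs, hcr] with x hsub hlt ho hs hcr
  have h : HasCrossingPairs c (x.1 : Vertices n) x.2 C := by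
    refine ⟨hsub, h₀.swap_mem, ?_, ?_⟩
    -- Distinct crossing times at `x₀` are strictly ordered, and the strict order persists.
    · intro p hp q hq hpq
      apply h₀.injOn hp hq
      by_contra hne
      rcases lt_or_gt_of_ne hne with h | h
      · exact (hlt p hp q hq h).ne hpq
      · exact (hlt q hq p hp h).ne' hpq
    · intro u u' h
      have hu := chainTimes_subset c n h.1
      have hu' := chainTimes_subset c n h.2.1
      have hn := h.pos
      obtain ⟨i, s, his, rfl⟩ := exists_edge_of_le hn hu.1 hu.2
      obtain ⟨j, t, hjt, rfl⟩ := exists_edge_of_le hn hu'.1 hu'.2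
      obtain ⟨hC, e1, e2⟩ := hcr i j s his t hjt h
      exact ⟨(i, j), hC, by rw [e1]; rfl, by rw [e2]; rfl⟩
  exact ⟨h.isGeneric, h₀.projectionDiagram_eq h hlt ho hs⟩

end

/-! ### Almost every direction is generic -/

open MeasureTheory

/-- By Fubini, a closed set met by every line of direction `w` in finitely many points has volume
zero. Spherical area is a multiple of the volume of the cone over a set, and the cone stays in the
zero set by `hhom`. -/
theorem ae_sphereArea_of_finite_slices {F : Space3 → ℝ} (hF : Continuous F)
    (hhom : ∀ (r : ℝ) (x : Space3), F x = 0 → F (r • x) = 0) (w : Space3)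
    (hfin : ∀ y, {t : ℝ | F (y + t • w) = 0}.Finite) :
    ∀ᵐ ξ : Direction ∂sphereArea, F (ξ : Space3) ≠ 0 := by
  have h1 : ∀ᵐ x ∂(volume : Measure Space3), x ∈ {x | F x ≠ 0} := by
    refine ae_mem_of_ae_add_linearMap_mem (LinearMap.toSpanSingleton ℝ Space3 w)
      (volume : Measure ℝ) _ (isOpen_ne_fun hF continuous_const).measurableSet fun y => ?_
    filter_upwards [(hfin y).countable.ae_notMem volume] with t ht
    simpa using ht
  have h2 : (volume : Measure Space3) {x | F x = 0} = 0 := by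
    rw [ae_iff] at h1
    simpa using h1
  have hm : MeasurableSet {ξ : Direction | F (ξ : Space3) = 0} :=
    (isClosed_eq (hF.comp continuous_subtype_val) continuous_const).measurableSet
  rw [ae_iff]
  simp only [ne_eq, not_not]
  unfold sphereArea
  rw [Measure.toSphere_apply' _ hm, measure_mono_null _ h2, mul_zero]
  rintro _ ⟨r, -, _, ⟨ξ, hξ, rfl⟩, rfl⟩
  exact hhom r _ hξ

theorem ae_sphereArea_linear_ne_zero {F : Space3 →ₗ[ℝ] ℝ} {w : Space3} (hw : F w ≠ 0) :
    ∀ᵐ ξ : Direction ∂sphereArea, F (ξ : Space3) ≠ 0 := by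
  refine ae_sphereArea_of_finite_slices F.continuous_of_finiteDimensional ?_ w fun y => ?_
  · intro r x hx
    rw [map_smul, hx, smul_zero]
  · refine (Set.finite_singleton (-F y / F w)).subset fun t ht => ?_
    simp only [Set.mem_ofPred_eq, map_add, map_smul, smul_eq_mul] at ht
    rw [Set.mem_singleton_iff, eq_div_iff hw]
    linarith

theorem ae_sphereArea_notMem_submodule {W : Submodule ℝ Space3} (hW : W ≠ ⊤) :
    ∀ᵐ ξ : Direction ∂sphereArea, (ξ : Space3) ∉ W := by
  obtain ⟨f, hf, hle⟩ := Submodule.exists_le_ker_of_lt_top W hW.lt_top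
  obtain ⟨w, hw⟩ : ∃ w, f w ≠ 0 := by
    by_contra! h
    exact hf (LinearMap.ext h)
  filter_upwards [ae_sphereArea_linear_ne_zero hw] with ξ hξ hmem
  exact hξ (hle hmem)

theorem span_pair_ne_top (a b : Space3) : Submodule.span ℝ {a, b} ≠ ⊤ := by
  intro h
  have h1 := finrank_span_finset_le_card (R := ℝ) ({a, b} : Finset Space3)
  have h2 : ({a, b} : Finset Space3).card ≤ 2 := Finset.card_le_two
  rw [Finset.coe_pair, Set.finrank, h, finrank_top, finrank_euclideanSpace_fin] at h1
  omega

/-- The triple product as a linear form in its last argument. -/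
def tripleProductForm (a b : Space3) : Space3 →ₗ[ℝ] ℝ where
  toFun x := tripleProduct a b x
  map_add' x y := by simp [tripleProduct]; ring
  map_smul' r x := by simp [tripleProduct]; ring

/-- It vanishes if, in the projection along `x`, the lines through `p`, `q`, `r` with the directions
`a`, `b`, `e` are concurrent. -/
def concurrencyForm (p a q b r e x : Space3) : ℝ :=
  tripleProduct a x p * tripleProduct b e x + tripleProduct b x q * tripleProduct e a x +
    tripleProduct e x r * tripleProduct a b x

theorem finite_quadratic_zeros {a b d : ℝ} (ha : a ≠ 0) :
    {t : ℝ | d + b * t + a * t ^ 2 = 0}.Finite := by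
  let P : Polynomial ℝ := Polynomial.C a * Polynomial.X ^ 2 + Polynomial.C b * Polynomial.X +
    Polynomial.C d
  have hP : P ≠ 0 := by
    intro h
    have := congrArg Polynomial.natDegree h
    rw [Polynomial.natDegree_quadratic ha, Polynomial.natDegree_zero] at this
    omega
  refine (Polynomial.finite_setOfPred_isRoot hP).subset fun t ht => ?_
  simp only [Set.mem_ofPred_eq] at ht
  simp only [Set.mem_ofPred_eq, Polynomial.IsRoot, P, Polynomial.eval_add, Polynomial.eval_mul,
    Polynomial.eval_C, Polynomial.eval_pow, Polynomial.eval_X]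
  linarith

theorem cramer_identity (a b e y : Space3) :
    tripleProduct a b y • e = tripleProduct e b y • a + tripleProduct a e y • b +
      tripleProduct a b e • y := by
  ext k
  fin_cases k <;> simp [tripleProduct] <;> ring

/-- Skewness is essential: for three lines through one point the form vanishes identically. If `a`,
`b`, `e` are independent, the quadratic form is nonzero at `a + b`; if they are dependent, it splits
into two nonzero linear forms. -/
theorem ae_concurrencyForm_ne_zero {p a q b r e : Space3} (hab : tripleProduct a b (q - p) ≠ 0)
    (hbe : tripleProduct b e (r - q) ≠ 0) (hae : tripleProduct a e (r - p) ≠ 0) :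
    ∀ᵐ ξ : Direction ∂sphereArea, concurrencyForm p a q b r e (ξ : Space3) ≠ 0 := by
  by_cases h : tripleProduct a b e = 0
  · have hc := cramer_identity a b e (q - p)
    rw [h, zero_smul, add_zero] at hc
    set δ := tripleProduct a b (q - p) with hδ
    set α := tripleProduct e b (q - p) / δ with hα
    set β := tripleProduct a e (q - p) / δ with hβ
    have he : e = α • a + β • b := by
      rw [hα, hβ, div_eq_inv_mul, div_eq_inv_mul, mul_smul, mul_smul, ← smul_add, ← hc, smul_smul,
        inv_mul_cancel₀ hab, one_smul]
    clear_value α β δ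
    subst he
    have hα0 : α ≠ 0 := by
      rintro rfl
      apply hbe
      simp [tripleProduct]
      ring
    have hβab : β * tripleProduct a b (r - p) ≠ 0 := by
      intro h0
      apply hae
      rw [← h0]
      simp [tripleProduct]
      ring
    -- The first linear factor takes at `b` the value `α * tripleProduct a b (r - p)`; the second
    -- factor is the triple product with `a` and `b`.
    have hL : (tripleProductForm r (α • a + β • b) - α • tripleProductForm p a -
        β • tripleProductForm q b) b ≠ 0 := by
      intro h0
      apply mul_ne_zero hα0 (right_ne_zero_of_mul hβab)
      rw [← h0]
      simp [tripleProductForm, tripleProduct]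
      ring
    have hD : tripleProductForm a b (q - p) ≠ 0 := fun h0 => hab (hδ.trans h0)
    filter_upwards [ae_sphereArea_linear_ne_zero hL, ae_sphereArea_linear_ne_zero hD]
      with ξ h1 h2 h3
    apply mul_ne_zero h1 h2
    rw [← h3]
    simp [tripleProductForm, tripleProduct, concurrencyForm]
    ring
  · have hQ : concurrencyForm p a q b r e (a + b) ≠ 0 := by
      intro h0
      apply mul_ne_zero h hab
      rw [← neg_eq_zero, ← h0]
      simp [tripleProduct, concurrencyForm]
      ring
    refine ae_sphereArea_of_finite_slices ?_ ?_ (a + b) fun y => ?_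
    · unfold concurrencyForm
      have := fun x y : Space3 =>
        tripleProduct_continuous (continuous_const (y := x)) (continuous_const (y := y))
          (continuous_id (X := Space3))
      have := fun x y : Space3 => tripleProduct_continuous (continuous_const (y := x))
          (continuous_id (X := Space3)) (continuous_const (y := y))
      simp only [id] at *
      fun_prop
    · intro s x hx
      have : concurrencyForm p a q b r e (s • x) = s ^ 2 * concurrencyForm p a q b r e x := by
        simp [tripleProduct, concurrencyForm]
        ring
      rw [this, hx, mul_zero]
    · have : ∀ (w : Space3) (t : ℝ), concurrencyForm p a q b r e (y + t • w) =
          concurrencyForm p a q b r e y +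
          (concurrencyForm p a q b r e (y + w) - concurrencyForm p a q b r e y -
            concurrencyForm p a q b r e w) * t + concurrencyForm p a q b r e w * t ^ 2 := by
        intro w t
        simp [tripleProduct, concurrencyForm]
        ring
      simp only [this (a + b)]
      exact finite_quadratic_zeros hQ

/-- The combination of `a`, `b`, `e` with coefficients `tripleProduct b e x`, `tripleProduct e a x`,
`tripleProduct a b x` is a multiple of `x`. So the equations of the three projected lines have
dependent linear parts, and at a common point their constant terms satisfy the same relation. -/
theorem concurrencyForm_eq_zero {p a q b r e x : Space3} {s t m l l' : ℝ}
    (h : (p + s • a) - (q + t • b) = l • x) (h' : (p + s • a) - (r + m • e) = l' • x) :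
    concurrencyForm p a q b r e x = 0 := by
  obtain rfl : q = p + s • a - t • b - l • x := by rw [← h]; abel
  obtain rfl : r = p + s • a - m • e - l' • x := by rw [← h']; abel
  simp [tripleProduct, concurrencyForm]
  ring

/-- Testing on the basis vectors says that the cross product of `a` and `b` is zero; then `⟨a, a⟩ b
= ⟨a, b⟩ a`. -/
theorem eq_smul_of_tripleProduct_eq_zero {a b : Space3} (ha : a ≠ 0)
    (h : ∀ x, tripleProduct a b x = 0) : ∃ m : ℝ, b = m • a := by
  have h0 := h (EuclideanSpace.single 0 1)
  have h1 := h (EuclideanSpace.single 1 1)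
  have h2 := h (EuclideanSpace.single 2 1)
  simp [tripleProduct] at h0 h1 h2
  refine ⟨inner ℝ a b / inner ℝ a a, ?_⟩
  have haa : inner ℝ a a ≠ 0 := by simpa using ha
  rw [div_eq_inv_mul, mul_smul, eq_inv_smul_iff₀ haa]
  simp only [EuclideanSpace.inner_eq_star_dotProduct, dotProduct, Fin.sum_univ_three]
  ext k
  fin_cases k <;> simp
  · linear_combination -(a 1) * h2 + (a 2) * h1
  · linear_combination -(a 2) * h0 + (a 0) * h2
  · linear_combination -(a 0) * h1 + (a 1) * h0

/-! ### Excluding the non-generic directions of a simple chain -/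

section

variable {c : ChainKind} {n : ℕ} {v : Vertices n}

theorem edge_ne_zero (hv : v ∈ chainSpace c n) (i : Fin n) : edge v i ≠ 0 := by
  intro h
  have h1 := hv.1 (edge_add_mem_chainTimes c i le_rfl zero_lt_one)
    (edge_add_mem_chainTimes c i (s := 1 / 2) (by norm_num) (by norm_num)) (by
      rw [chainPoint_add v i (by norm_num), chainPoint_add v i (by norm_num), edgePoint, edgePoint,
        h, smul_zero, smul_zero])
  norm_num at h1

theorem Crosses.exists_smul {ξ : Direction} {u u' : ℝ} (hv : v ∈ chainSpace c n)
    (h : Crosses c v ξ u u') :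
    ∃ l : ℝ, l ≠ 0 ∧ chainPoint v u - chainPoint v u' = l • (ξ : Space3) := by
  obtain ⟨l, hl⟩ := planeProjection_eq_planeProjection_iff.1 h.2.2.2
  refine ⟨l, ?_, hl⟩
  rintro rfl
  rw [zero_smul, sub_eq_zero] at hl
  exact h.2.2.1 (hv.1 h.1 h.2.1 hl)

theorem Crosses.exists_edges {ξ : Direction} {u u' : ℝ} (h : Crosses c v ξ u u')
    (hu : ∀ k : ℕ, u ≠ k) : ∃ (i : Fin n) (s : ℝ), s ∈ Set.Ioo (0 : ℝ) 1 ∧ u = i + s := by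
  have h1 := chainTimes_subset c n h.1
  obtain ⟨i, s, h0, hs, e⟩ := exists_edge_of_lt h1.1 (lt_of_le_of_ne h1.2 (hu n))
  refine ⟨i, s, ⟨lt_of_le_of_ne h0 ?_, hs⟩, e⟩
  rintro rfl
  exact hu i (by simpa using e)

/-- Since the chain is simple, the two points over such a crossing differ by a nonzero multiple of
`ξ`; this puts `ξ` into the span of two vectors that depend only on the vertex and the edge. -/
theorem ae_vertex_not_crossing (hv : v ∈ chainSpace c n) :
    ∀ᵐ ξ : Direction ∂sphereArea, ∀ u u', Crosses c v ξ u u' → ∀ k : ℕ, u ≠ k := by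
  have h : ∀ᵐ ξ : Direction ∂sphereArea, ∀ (k : Fin (n + 1)) (j : Fin n),
      (ξ : Space3) ∉ Submodule.span ℝ {v k - v j.castSucc, edge v j} :=
    ae_all_iff.2 fun k => ae_all_iff.2 fun j =>
      ae_sphereArea_notMem_submodule (span_pair_ne_top _ _)
  filter_upwards [h] with ξ hξ
  rintro _ u' hc k rfl
  have hk := chainTimes_subset c n hc.1
  have hu' := chainTimes_subset c n hc.2.1
  have hk' : k ≤ n := by exact_mod_cast hk.2
  have hn := hc.pos
  obtain ⟨j, t, ht, rfl⟩ := exists_edge_of_le hn hu'.1 hu'.2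
  obtain ⟨l, hl, e⟩ := hc.exists_smul hv
  have ek := chainPoint_natCast v ⟨k, by omega⟩
  simp only at ek
  rw [ek, chainPoint_add v j ht] at e
  apply hξ ⟨k, by omega⟩ j
  rw [Submodule.mem_span_pair]
  refine ⟨l⁻¹, -(l⁻¹ * t), ?_⟩
  rw [← inv_smul_smul₀ hl (ξ : Space3), ← e, edgePoint]
  module

/-- For non-parallel edges the triple product is a nonzero linear form in `ξ`. Parallel edges,
including `i = j`, can cross only along directions in the span of two fixed vectors. -/
theorem ae_transversal (hv : v ∈ chainSpace c n) (i j : Fin n) :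
    ∀ᵐ ξ : Direction ∂sphereArea, ∀ s ∈ Set.Icc (0 : ℝ) 1, ∀ t ∈ Set.Icc (0 : ℝ) 1,
      Crosses c v ξ (i + s) (j + t) → tripleProduct (edge v i) (edge v j) ξ ≠ 0 := by
  by_cases h : ∃ x, tripleProduct (edge v i) (edge v j) x ≠ 0
  · obtain ⟨x, hx⟩ := h
    filter_upwards [ae_sphereArea_linear_ne_zero
      (F := tripleProductForm (edge v i) (edge v j)) hx] with ξ hξ s _ t _ _
    exact hξ
  · push Not at h
    obtain ⟨m, hm⟩ := eq_smul_of_tripleProduct_eq_zero (edge_ne_zero hv i) h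
    filter_upwards [ae_sphereArea_notMem_submodule
      (span_pair_ne_top (v i.castSucc - v j.castSucc) (edge v i))] with ξ hξ s hs t ht hc
    obtain ⟨l, hl, e⟩ := hc.exists_smul hv
    rw [chainPoint_add v i hs, chainPoint_add v j ht, edgePoint, edgePoint, hm] at e
    exfalso
    apply hξ
    rw [Submodule.mem_span_pair]
    refine ⟨l⁻¹, l⁻¹ * (s - t * m), ?_⟩
    rw [← inv_smul_smul₀ hl (ξ : Space3), ← e]
    module

theorem ae_isGeneric (hv : v ∈ chainSpace c n) : ∀ᵐ ξ : Direction ∂sphereArea, IsGeneric c v ξ := by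
  have h2 : ∀ᵐ ξ : Direction ∂sphereArea, ∀ i j : Fin n, ∀ s ∈ Set.Icc (0 : ℝ) 1, ∀ t ∈ Set.Icc (0 : ℝ) 1,
      Crosses c v ξ (i + s) (j + t) → tripleProduct (edge v i) (edge v j) ξ ≠ 0 :=
    ae_all_iff.2 fun i => ae_all_iff.2 fun j => ae_transversal hv i j
  have h3 : ∀ᵐ ξ : Direction ∂sphereArea, ∀ i j k : Fin n,
      tripleProduct (edge v i) (edge v j) (v j.castSucc - v i.castSucc) ≠ 0 →
      tripleProduct (edge v j) (edge v k) (v k.castSucc - v j.castSucc) ≠ 0 →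
      tripleProduct (edge v i) (edge v k) (v k.castSucc - v i.castSucc) ≠ 0 →
      concurrencyForm (v i.castSucc) (edge v i) (v j.castSucc) (edge v j) (v k.castSucc)
        (edge v k) ξ ≠ 0 := by
    simp only [ae_all_iff, eventually_imp_distrib_left]
    exact fun i j k => ae_concurrencyForm_ne_zero
  filter_upwards [ae_vertex_not_crossing hv, h2, h3] with ξ h1 h2 h3
  -- For coplanar edge lines Cramer's rule gives `l = 0`, so the points over the crossing would
  -- coincide in space.
  have hskew : ∀ (i j : Fin n) (s t : ℝ), s ∈ Set.Icc (0 : ℝ) 1 → t ∈ Set.Icc (0 : ℝ) 1 →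
      Crosses c v ξ (i + s) (j + t) →
      tripleProduct (edge v i) (edge v j) (v j.castSucc - v i.castSucc) ≠ 0 ∧
        ∃ l : ℝ, edgePoint v i s - edgePoint v j t = l • (ξ : Space3) := by
    intro i j s t hs ht hc
    obtain ⟨l, hl, e⟩ := hc.exists_smul hv
    rw [chainPoint_add v i hs, chainPoint_add v j ht] at e
    refine ⟨?_, l, e⟩
    intro h0
    have := ((edgePoint_sub_edgePoint_iff (h2 i j s hs t ht hc)).1 e).2.2
    rw [h0, zero_div, neg_zero] at this
    exact hl this
  intro u u' hc
  obtain ⟨i, s, hs, rfl⟩ := hc.exists_edges (h1 _ _ hc)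
  obtain ⟨j, t, ht, rfl⟩ := hc.symm.exists_edges (h1 _ _ hc.symm)
  have hs' := Set.Ioo_subset_Icc_self hs
  have ht' := Set.Ioo_subset_Icc_self ht
  refine ⟨h1 _ _ hc, ?_, ?_⟩
  · rw [planarDet_eq, edgeVector_add v i hs.1.le hs.2, edgeVector_add v j ht.1.le ht.2]
    exact h2 i j s hs' t ht' hc
  · intro u'' hc'
    by_contra hne
    -- A third time at the double point makes three pairwise skew edges concurrent in the
    -- projection.
    have hc'' := hc.symm.trans hc' (Ne.symm hne)
    obtain ⟨k, r, hr, rfl⟩ := hc'.symm.exists_edges (h1 _ _ hc'.symm)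
    have hr' := Set.Ioo_subset_Icc_self hr
    obtain ⟨a1, l1, e1⟩ := hskew i j s t hs' ht' hc
    obtain ⟨a2, l2, e2⟩ := hskew i k s r hs' hr' hc'
    obtain ⟨a3, -⟩ := hskew j k t r ht' hr' hc''
    exact h3 i j k a1 a3 a2 (concurrencyForm_eq_zero e1 e2)

end

/-! ### Finitely many diagrams -/

theorem finite_gaussWords (N : ℕ) :
    {w : GaussWord | w.length ≤ N ∧ ∀ p ∈ w, p.label ≤ N}.Finite := by
  let f : Fin (N + 1) × Bool × Bool → Passage := fun q => ⟨q.1, q.2.1, q.2.2⟩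
  refine ((List.finite_length_le (Fin (N + 1) × Bool × Bool) N).image (List.map f)).subset ?_
  rintro w ⟨hl, hw⟩
  have hr : w ∈ Set.range (List.map f) := by
    rw [Set.range_list_map]
    intro p hp
    exact ⟨(⟨p.label, by have := hw p hp; omega⟩, p.isOver, p.isPositive), rfl⟩
  obtain ⟨l, rfl⟩ := hr
  exact ⟨l, by simpa using hl, rfl⟩

section

variable {c : ChainKind} {n : ℕ} {v : Vertices n}

/-- Crossing times are indexed by ordered pairs of edges, and both the length and the labels count
crossing times. -/
theorem IsGeneric.projectionDiagram_bound {ξ : Direction} (hg : IsGeneric c v ξ) :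
    (projectionDiagram c v ξ).length ≤ n * n ∧
      ∀ p ∈ projectionDiagram c v ξ, p.label ≤ n * n := by
  have hX : crossingTimes c v ξ = crossingTime v ξ '' crossingPairs v ξ :=
    hg.hasCrossingPairs.crossingTimes_eq
  have hfin : (crossingTimes c v ξ).Finite := by
    rw [hX]
    exact (Set.toFinite _).image _
  have hcard : (crossingTimes c v ξ).ncard ≤ n * n := by
    rw [hX]
    refine (Set.ncard_image_le (Set.toFinite _)).trans ((Set.ncard_le_card _).trans ?_)
    simp
  unfold projectionDiagram
  rw [dif_pos hfin]
  constructor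
  · rw [List.length_map, Finset.length_sort, ← Set.ncard_eq_toFinset_card _ hfin]
    exact hcard
  · intro p hp
    obtain ⟨u, -, rfl⟩ := List.mem_map.1 hp
    exact (Set.ncard_le_ncard (Set.sep_subset _ _) hfin).trans hcard

theorem realizableDiagrams_finite (c : ChainKind) (n : ℕ) : (realizableDiagrams c n).Finite := by
  refine (finite_gaussWords (n * n)).subset ?_
  rintro _ ⟨v, -, ξ, hg, rfl⟩
  exact hg.projectionDiagram_bound

/-! ### Measurability and continuity of the probabilities -/

/-- Local constancy of the diagram makes the set open for every `P`, so no structure of `P`, such as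
Reidemeister equivalence, matters. -/
theorem directionSet_isOpen (hv : v ∈ chainSpace c n) (P : Set GaussWord) :
    IsOpen (directionSet c v P) := by
  rw [isOpen_iff_mem_nhds]
  rintro ξ ⟨hg, hP⟩
  have h := eventually_isGeneric_and_projectionDiagram_eq
    (x₀ := ((⟨v, hv⟩ : chainSpace c n), ξ)) hg
  have hc : Continuous fun ζ : Direction => ((⟨v, hv⟩ : chainSpace c n), ζ) := by fun_prop
  filter_upwards [hc.tendsto ξ |>.eventually h] with ζ hζ
  refine ⟨hζ.1, ?_⟩
  rw [hζ.2]
  exact hP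

theorem directionSet_measurableSet (hv : v ∈ chainSpace c n) (P : Set GaussWord) :
    MeasurableSet (directionSet c v P) :=
  (directionSet_isOpen hv P).measurableSet

instance : IsFiniteMeasure sphereArea := by
  unfold sphereArea
  infer_instance

/-- For a direction generic for `v₀`, membership in the direction set is constant for `v` near `v₀`.
So the indicators converge almost everywhere, and on a finite measure space so do the measures. -/
theorem projectionProb_continuous (c : ChainKind) (n : ℕ) (P : Set GaussWord) :
    Continuous fun v : chainSpace c n => projectionProb c (v : Vertices n) P := by
  refine Continuous.div_const (continuous_iff_continuousAt.2 fun v₀ => ?_) _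
  refine (ENNReal.tendsto_toReal (measure_ne_top _ _)).comp
    (tendsto_measure_of_ae_tendsto_indicator_of_isFiniteMeasure (𝓝 v₀)
      (directionSet_measurableSet v₀.2 P) (fun v => directionSet_measurableSet v.2 P) ?_)
  filter_upwards [ae_isGeneric v₀.2] with ξ hg
  have h := eventually_isGeneric_and_projectionDiagram_eq (x₀ := (v₀, ξ)) hg
  have hc : Continuous fun v : chainSpace c n => (v, ξ) := by fun_prop
  filter_upwards [hc.tendsto v₀ |>.eventually h] with v hv
  unfold directionSet
  simp only [Set.mem_ofPred_eq, hv.1, hv.2, hg]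

/-! ### The bracket polynomial of a chain -/

theorem sphereArea_real_univ : sphereArea.real Set.univ = 4 * Real.pi := by
  unfold sphereArea
  rw [Measure.toSphere_real_apply_univ, finrank_euclideanSpace_fin, Measure.real,
    EuclideanSpace.volume_ball_fin_three]
  rw [ENNReal.toReal_mul, ENNReal.toReal_pow, ENNReal.toReal_ofReal zero_le_one,
    ENNReal.toReal_ofReal (by positivity)]
  norm_num
  ring

/-- Finiteness of the set of diagrams ensures that the `finsum` is a genuine sum and not its default
value. -/
theorem chainBracket_eq_sum (c : ChainKind) (v : Vertices n) :
    chainBracket c v =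
      ∑ K ∈ (realizableDiagrams_finite c n).toFinset, diagramProb c v K • bracket c K :=
  finsum_mem_eq_finite_toFinset_sum _ _

theorem chainBracket_coeff (c : ChainKind) (v : Vertices n) (k : ℤ) :
    (chainBracket c v).coeff k =
      ∑ K ∈ (realizableDiagrams_finite c n).toFinset,
        diagramProb c v K * (bracket c K).coeff k := by
  rw [chainBracket_eq_sum, AddMonoidAlgebra.coeff_sum, Finset.sum_apply']
  rfl

/-- This partition reduces the bracket integral to pieces on which the integrand is constant. -/
theorem setOf_isGeneric_eq_biUnion (hv : v ∈ chainSpace c n) :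
    {ξ | IsGeneric c v ξ} =
      ⋃ K ∈ (realizableDiagrams_finite c n).toFinset, directionSet c v {K} := by
  ext ξ
  simp only [Set.mem_iUnion, Set.Finite.mem_toFinset]
  constructor
  · intro hg
    exact ⟨_, ⟨v, hv, ξ, hg, rfl⟩, hg, rfl⟩
  · rintro ⟨K, -, hg, -⟩
    exact hg

theorem bracket_integrableOn_directionSet (hv : v ∈ chainSpace c n) (K : GaussWord) (k : ℤ) :
    IntegrableOn (fun ξ => (bracket c (projectionDiagram c v ξ)).coeff k)
      (directionSet c v {K}) sphereArea := by
  refine (integrableOn_const (C := (bracket c K).coeff k) (measure_ne_top _ _)).congr_fun ?_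
    (directionSet_measurableSet hv _)
  rintro ξ ⟨-, hK⟩
  rw [Set.mem_singleton_iff] at hK
  simp only [hK]

theorem bracket_integrableOn (hv : v ∈ chainSpace c n) (k : ℤ) :
    IntegrableOn (fun ξ => (bracket c (projectionDiagram c v ξ)).coeff k)
      {ξ | IsGeneric c v ξ} sphereArea := by
  rw [setOf_isGeneric_eq_biUnion hv, integrableOn_finset_iUnion]
  exact fun K _ => bracket_integrableOn_directionSet hv K k

theorem chainBracket_coeff_eq_integral (hv : v ∈ chainSpace c n) (k : ℤ) :
    (chainBracket c v).coeff k =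
      (1 / (4 * Real.pi)) * ∫ ξ in {ξ | IsGeneric c v ξ},
        (bracket c (projectionDiagram c v ξ)).coeff k ∂sphereArea := by
  rw [setOf_isGeneric_eq_biUnion hv, integral_biUnion_finset _
    (fun K _ => directionSet_measurableSet hv {K}) ?_
    (fun K _ => bracket_integrableOn_directionSet hv K k), chainBracket_coeff, Finset.mul_sum]
  · refine Finset.sum_congr rfl fun K _ => ?_
    have : ∫ ξ in directionSet c v {K}, (bracket c (projectionDiagram c v ξ)).coeff k ∂sphereArea =
        ∫ _ in directionSet c v {K}, (bracket c K).coeff k ∂sphereArea := by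
      refine setIntegral_congr_fun (directionSet_measurableSet hv _) ?_
      rintro ξ ⟨-, hK⟩
      rw [Set.mem_singleton_iff] at hK
      simp only [hK]
    rw [this, setIntegral_const, diagramProb, projectionProb, sphereArea_real_univ, smul_eq_mul]
    ring
  · intro K _ K' _ hne
    rw [Function.onFun, Set.disjoint_left]
    rintro ξ ⟨-, h1⟩ ⟨-, h2⟩
    exact hne (h1.symm.trans h2)

/-! ### Degree bounds and continuity of the coefficient vector -/

theorem exists_hasDegreeLE (f : ℝ[T;T⁻¹]) : ∃ m : ℕ, HasDegreeLE m f := by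
  refine ⟨f.coeff.support.sup Int.natAbs, fun k hk => ?_⟩
  have := Finset.le_sup (f := Int.natAbs) (Finsupp.mem_support_iff.2 hk)
  omega

theorem HasDegreeLE.mono {m m' : ℕ} (h : m ≤ m') {f : ℝ[T;T⁻¹]} (hf : HasDegreeLE m f) :
    HasDegreeLE m' f := by
  intro k hk
  have := hf k hk
  omega

theorem exists_hasDegreeLE_bracket (c : ChainKind) (n : ℕ) :
    ∃ m : ℕ, ∀ K ∈ realizableDiagrams c n, HasDegreeLE m (bracket c K) := by
  choose d hd using fun K : GaussWord => exists_hasDegreeLE (bracket c K)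
  refine ⟨(realizableDiagrams_finite c n).toFinset.sup d, fun K hK => (hd K).mono ?_⟩
  exact Finset.le_sup (f := d) ((realizableDiagrams_finite c n).mem_toFinset.2 hK)

theorem hasDegreeLE_chainBracket {m : ℕ}
    (h : ∀ K ∈ realizableDiagrams c n, HasDegreeLE m (bracket c K)) (v : Vertices n) :
    HasDegreeLE m (chainBracket c v) := by
  intro k hk
  rw [chainBracket_coeff] at hk
  obtain ⟨K, hK, hne⟩ := Finset.exists_ne_zero_of_sum_ne_zero hk
  exact h K ((realizableDiagrams_finite c n).mem_toFinset.1 hK) k (right_ne_zero_of_mul hne)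

theorem coeffVector_chainBracket_continuous (c : ChainKind) (n m : ℕ) :
    Continuous fun v : chainSpace c n => coeffVector m (chainBracket c (v : Vertices n)) := by
  refine (PiLp.continuous_toLp 2 _).comp (continuous_pi fun k => ?_)
  simp only [chainBracket_coeff]
  exact continuous_finsetSum _ fun K _ => (projectionProb_continuous c n {K}).mul continuous_const

end

theorem mainTheorem1 (c : ChainKind) (n : ℕ) :
    -- finitely many diagrams occur, and almost all directions are generic
    (realizableDiagrams c n).Finite ∧
    (∀ v ∈ chainSpace c n, ∀ᵐ ξ ∂sphereArea, IsGeneric c v ξ) ∧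
    -- each probability is well defined and continuous: for every class of diagrams, ...
    (∀ P : Set GaussWord,
      (∀ v ∈ chainSpace c n, MeasurableSet (directionSet c v P)) ∧
      Continuous fun v : chainSpace c n => projectionProb c (v : Vertices n) P) ∧
    -- ... in particular for every diagram, and for every knotoid (knot) type
    (∀ K : GaussWord, Continuous fun v : chainSpace c n => diagramProb c (v : Vertices n) K) ∧
    (∀ K : GaussWord, Continuous fun v : chainSpace c n => typeProb c (v : Vertices n) K) ∧
    -- the bracket polynomial is the average of the brackets of the projections
    (∀ v ∈ chainSpace c n, ∀ k : ℤ,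
      MeasureTheory.IntegrableOn (fun ξ => (bracket c (projectionDiagram c v ξ)).coeff k)
        {ξ | IsGeneric c v ξ} sphereArea ∧
      (chainBracket c v).coeff k =
        (1 / (4 * Real.pi)) * ∫ ξ in {ξ | IsGeneric c v ξ},
          (bracket c (projectionDiagram c v ξ)).coeff k ∂sphereArea) ∧
    -- it takes values in a space of Laurent polynomials of bounded degree, and it is continuous
    -- for the Euclidean norm there
    ∃ m : ℕ,
      (∀ K ∈ realizableDiagrams c n, HasDegreeLE m (bracket c K)) ∧
      (∀ v ∈ chainSpace c n, HasDegreeLE m (chainBracket c v)) ∧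
      Continuous fun v : chainSpace c n => coeffVector m (chainBracket c (v : Vertices n)) := by
  obtain ⟨m, hm⟩ := exists_hasDegreeLE_bracket c n
  exact ⟨realizableDiagrams_finite c n, fun v hv => ae_isGeneric hv,
    fun P => ⟨fun v hv => directionSet_measurableSet hv P, projectionProb_continuous c n P⟩,
    fun K => projectionProb_continuous c n {K},
    fun K => projectionProb_continuous c n {w | DiagramEquiv c K w},
    fun v hv k => ⟨bracket_integrableOn hv k, chainBracket_coeff_eq_integral hv k⟩,
    m, hm, fun v _ => hasDegreeLE_chainBracket hm v, coeffVector_chainBracket_continuous c n m⟩
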